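/- Let $(M,\bar g)$ be a hyperkähler manifold of real dimension $4n$, i.e. a Riemannian manifold with smooth $\bar g$-orthogonal endomorphism fields $J_1,J_2,J_3$ of $TM$ which are parallel for the Levi-Civita connection of $\bar g$ and satisfy $J_1^2=J_2^2=J_3^2=J_1J_2J_3=-\mathrm{Id}$. For $c\in S^2\subset\mathbb R^3$ put $J_c=\sum_d c_dJ_d$, and for $k\in S^2$ orthogonal to $c$ put $\Omega_{c}=\bar g(J_cJ_k\,\cdot,\cdot)-\sqrt{-1}\,\bar g(J_k\,\cdot,\cdot)$ (up to a unit complex factor this does not depend on $k$). Let $F\colon L\to M$ be a smooth immersion of a $2n$-dimensional manifold, equipped with the induced metric $g=F^*\bar g$ and its Riemannian volume $d\mu$, and suppose that $L$ is hyper-Lagrangian with complex phase $\Psi$, i.e. $\Psi=(a_1,a_2,a_3)\colon L\to S^2$ is a smooth map such that $\Omega_{\Psi(x)}$ vanishes on $dF(T_xL)$ for every $x\in L$. Let $H$ be the mean curvature vector, i.e. the trace with respect to $g$ of the second fundamental form of $F$, and let $|\nabla\Psi|^2=\sum_d|\nabla a_d|_g^2$ be the energy density of $\Psi$. Then, at every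 point of $L$, $$|H|^2\le 2\,|\nabla\Psi|^2 .$$ Consequently $$\int_L|H|^2\,d\mu\;\le\;2\,\mathcal T(L),\qquad \mathcal T(L):=\int_L|\nabla\Psi|^2\,d\mu ,$$ where $\mathcal T(L)$ is the twistor energy and both integrals take values in $[0,\infty]$. -/

import Mathlib

open scoped Manifold ContDiff Bundle InnerProductSpace ENNReal
open MeasureTheory Bundle

noncomputable section

namespace HyperLagrangian

/-! ### Riemannian geometry in the preferred charts

`M` is a manifold without boundary modelled on the finite-dimensional space `E`; its metric is the
`RiemannianBundle` structure on the tangent bundle.  In Mathlib `TangentSpace 𝓘(ℝ, E) p` is by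
definition `E`, a tangent vector being identified with its components in the preferred chart at `p`
(see `coordFrame_self`).  Tensors at `p` are computed in that chart. -/

section Riemannian

variable {E : Type*} [NormedAddCommGroup E] [NormedSpace ℝ E]
  {M : Type*} [TopologicalSpace M] [ChartedSpace E M]

/-- The coordinate frame of the chart `φ` at `p`: at the point with coordinates `y`, the vector with
components `u` is `∑ uⁱ ∂ᵢ = d(φ⁻¹)_y u`. -/
def coordFrame (p : M) (y : E) : E →L[ℝ] TangentSpace 𝓘(ℝ, E) ((extChartAt 𝓘(ℝ, E) p).symm y) :=
  mfderiv 𝓘(ℝ, E) 𝓘(ℝ, E) (extChartAt 𝓘(ℝ, E) p).symm y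

/-- The coordinate coframe of the chart `φ` at `p`: the components `dφ v` of a tangent vector `v` at
the point with coordinates `y`. -/
def coordCoframe (p : M) (y : E) :
    TangentSpace 𝓘(ℝ, E) ((extChartAt 𝓘(ℝ, E) p).symm y) →L[ℝ] E :=
  mfderiv 𝓘(ℝ, E) 𝓘(ℝ, E) (extChartAt 𝓘(ℝ, E) p) ((extChartAt 𝓘(ℝ, E) p).symm y)

/-- At the centre of the preferred chart, a tangent vector is equal to its components. -/
theorem coordFrame_self [IsManifold 𝓘(ℝ, E) ∞ M] (p : M) (u : E) :
    coordFrame p (extChartAt 𝓘(ℝ, E) p p) u = u := by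
  have h := mfderivWithin_range_extChartAt_symm (I := 𝓘(ℝ, E)) (x := p)
  simp only [ModelWithCorners.range_eq_univ, mfderivWithin_univ] at h
  exact congrArg (fun A : E →L[ℝ] E ↦ A u) h

/-- An endomorphism field in the chart at `p`: the matrix `Jⁱ_j(y)`. -/
def coordEnd (J : ∀ p : M, TangentSpace 𝓘(ℝ, E) p →L[ℝ] TangentSpace 𝓘(ℝ, E) p) (p : M) (y : E) :
    E →L[ℝ] E :=
  (coordCoframe p y) ∘L (J ((extChartAt 𝓘(ℝ, E) p).symm y)) ∘L (coordFrame p y)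

variable [RiemannianBundle (fun p : M ↦ TangentSpace 𝓘(ℝ, E) p)]

/-- The metric in the chart at `p`: `(u, v) ↦ ∑ g_{ij}(y) uⁱ vʲ`. -/
def coordMetric (p : M) (y : E) : E →L[ℝ] E →L[ℝ] ℝ :=
  (innerSL ℝ (E := TangentSpace 𝓘(ℝ, E) ((extChartAt 𝓘(ℝ, E) p).symm y))).bilinearComp
    (coordFrame p y) (coordFrame p y)

set_option synthInstance.maxHeartbeats 80000 in
/-- The first derivatives of the metric at `p`: `coordMetricDeriv p w u v = ∑ (∂_k g_{ij}) wᵏ uⁱ vʲ`.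
-/
def coordMetricDeriv (p : M) : E →L[ℝ] E →L[ℝ] E →L[ℝ] ℝ :=
  fderiv ℝ (coordMetric p) (extChartAt 𝓘(ℝ, E) p p)

/-- The Christoffel symbols of the first kind at `p`:
`w ↦ ½ ∑ (∂_i g_{jk} + ∂_j g_{ik} - ∂_k g_{ij}) uⁱ vʲ wᵏ`. -/
def christoffelLower (p : M) (u v : E) : E →L[ℝ] ℝ :=
  (1 / 2 : ℝ) • (coordMetricDeriv p u v + coordMetricDeriv p v u
    - ((coordMetricDeriv p).flip u).flip v)

variable [FiniteDimensional ℝ E]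

instance instFiniteDimensionalTangent (p : M) : FiniteDimensional ℝ (TangentSpace 𝓘(ℝ, E) p) :=
  inferInstanceAs (FiniteDimensional ℝ E)

instance instCompleteTangent (p : M) : CompleteSpace (TangentSpace 𝓘(ℝ, E) p) :=
  FiniteDimensional.complete ℝ _

/-- The Christoffel symbols of the Levi-Civita connection at `p`, as the vector
`∑ Γᵏ_{ij} uⁱ vʲ ∂_k`: the index of `christoffelLower` is raised with the metric. -/
def christoffel (p : M) (u v : TangentSpace 𝓘(ℝ, E) p) : TangentSpace 𝓘(ℝ, E) p :=
  (InnerProductSpace.toDual ℝ (TangentSpace 𝓘(ℝ, E) p)).symm (christoffelLower (E := E) p u v)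

/-- The Levi-Civita covariant derivative `(∇_u J) v` of an endomorphism field at `p`:
`(∂_i Jᵏ_j + Γᵏ_{il} Jˡ_j - Γˡ_{ij} Jᵏ_l) uⁱ vʲ`. -/
def covDerivEnd (J : ∀ p : M, TangentSpace 𝓘(ℝ, E) p →L[ℝ] TangentSpace 𝓘(ℝ, E) p) (p : M)
    (u v : TangentSpace 𝓘(ℝ, E) p) : TangentSpace 𝓘(ℝ, E) p :=
  let dJ : TangentSpace 𝓘(ℝ, E) p := fderiv ℝ (coordEnd J p) (extChartAt 𝓘(ℝ, E) p p) u v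
  dJ + christoffel p u (J p v) - J p (christoffel p u v)

end Riemannian

/-! ### Immersed submanifolds -/

section Submanifold

variable {E₁ : Type*} [NormedAddCommGroup E₁] [NormedSpace ℝ E₁]
  {E₂ : Type*} [NormedAddCommGroup E₂] [NormedSpace ℝ E₂]
  {L : Type*} [TopologicalSpace L] [ChartedSpace E₁ L]
  [RiemannianBundle (fun x : L ↦ TangentSpace 𝓘(ℝ, E₁) x)]
  {M : Type*} [TopologicalSpace M] [ChartedSpace E₂ M]
  [RiemannianBundle (fun p : M ↦ TangentSpace 𝓘(ℝ, E₂) p)]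

/-- `F : L → M` is a smooth isometric immersion: the metric of `L` is the induced metric `F^* ḡ`.
(The differential of `F` is then injective.) -/
structure IsIsometricImmersion (F : L → M) : Prop where
  contMDiff : ContMDiff 𝓘(ℝ, E₁) 𝓘(ℝ, E₂) ∞ F
  inner_mfderiv : ∀ (x : L) (u v : TangentSpace 𝓘(ℝ, E₁) x),
    ⟪mfderiv 𝓘(ℝ, E₁) 𝓘(ℝ, E₂) F x u, mfderiv 𝓘(ℝ, E₁) 𝓘(ℝ, E₂) F x v⟫_ℝ = ⟪u, v⟫_ℝ

variable [FiniteDimensional ℝ E₁] [FiniteDimensional ℝ E₂]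

/-- The tangent plane `dF(T_x L)` in `T_{F x} M`. -/
def tangentPlane (F : L → M) (x : L) : Submodule ℝ (TangentSpace 𝓘(ℝ, E₂) (F x)) :=
  LinearMap.range (mfderiv 𝓘(ℝ, E₁) 𝓘(ℝ, E₂) F x).toLinearMap

/-- The ambient Levi-Civita derivative `∇̄_u (dF V)` along `F`, where `V` is the coordinate vector
field of `L` with constant components `v`: `(∂_i ∂_j Fᵏ + Γᵏ_{ab} ∂_i Fᵃ ∂_j Fᵇ) uⁱ vʲ`. -/
def ambientDeriv (F : L → M) (x : L) (u v : TangentSpace 𝓘(ℝ, E₁) x) :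
    TangentSpace 𝓘(ℝ, E₂) (F x) :=
  let d2F : TangentSpace 𝓘(ℝ, E₂) (F x) :=
    fderiv ℝ (fderiv ℝ (writtenInExtChartAt 𝓘(ℝ, E₁) 𝓘(ℝ, E₂) x F)) (extChartAt 𝓘(ℝ, E₁) x x) u v
  d2F + christoffel (F x) (mfderiv 𝓘(ℝ, E₁) 𝓘(ℝ, E₂) F x u) (mfderiv 𝓘(ℝ, E₁) 𝓘(ℝ, E₂) F x v)

/-- The second fundamental form `A(u, v) = (∇̄_u dF V)^⊥`, the component normal to `L`. -/
def secondFundamentalForm (F : L → M) (x : L) (u v : TangentSpace 𝓘(ℝ, E₁) x) :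
    TangentSpace 𝓘(ℝ, E₂) (F x) :=
  (tangentPlane (E₁ := E₁) F x)ᗮ.starProjection (ambientDeriv F x u v)

/-- The mean curvature vector `H = ∑ A(eᵢ, eᵢ)`, the trace of the second fundamental form, with
`eᵢ` an orthonormal basis of `T_x L`. -/
def meanCurvature (F : L → M) (x : L) : TangentSpace 𝓘(ℝ, E₂) (F x) :=
  ∑ i, secondFundamentalForm F x (stdOrthonormalBasis ℝ (TangentSpace 𝓘(ℝ, E₁) x) i)
    (stdOrthonormalBasis ℝ (TangentSpace 𝓘(ℝ, E₁) x) i)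

end Submanifold

/-! ### Riemannian volume -/

section Volume

variable {m : ℕ} {L : Type*} [TopologicalSpace L] [ChartedSpace (EuclideanSpace ℝ (Fin m)) L]
  [RiemannianBundle (fun x : L ↦ TangentSpace (𝓡 m) x)] [MeasurableSpace L]

/-- The measure `√(det g_{ij}) dy¹ ⋯ dyᵐ` on the domain of the chart at `x`. -/
def chartVolume (x : L) : Measure L :=
  ((volume.restrict (extChartAt (𝓡 m) x).target).withDensity (fun y ↦ ENNReal.ofReal (Real.sqrt
    (Matrix.det (Matrix.of fun i j : Fin m ↦ coordMetric x y
      (EuclideanSpace.single i (1 : ℝ)) (EuclideanSpace.single j (1 : ℝ))))))).map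
    (extChartAt (𝓡 m) x).symm

variable (m L) in
/-- The Riemannian volume measure: the least measure that dominates the measures
`√(det g_{ij}) dy¹ ⋯ dyᵐ` of the charts.  As these agree on overlaps, it restricts to each of
them. -/
def riemannianVolume : Measure L := ⨆ x : L, chartVolume (m := m) x

end Volume

/-! ### Hyperkähler manifolds and hyper-Lagrangian submanifolds -/

section Hyperkahler

variable {E : Type*} [NormedAddCommGroup E] [NormedSpace ℝ E] [FiniteDimensional ℝ E]
  {M : Type*} [TopologicalSpace M] [ChartedSpace E M] [IsManifold 𝓘(ℝ, E) ∞ M]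
  [RiemannianBundle (fun p : M ↦ TangentSpace 𝓘(ℝ, E) p)]

/-- `J₁, J₂, J₃` is a hyperkähler structure on the Riemannian manifold `M`: the `J_d` are smooth
fields of orthogonal endomorphisms of the tangent spaces with
`J₁² = J₂² = J₃² = J₁ J₂ J₃ = -Id`, and they are parallel for the Levi-Civita connection; that is,
they reduce the holonomy to `Sp(n)`, and each of them is a Kähler structure. -/
structure IsHyperkahler
    (J : Fin 3 → ∀ p : M, TangentSpace 𝓘(ℝ, E) p →L[ℝ] TangentSpace 𝓘(ℝ, E) p) : Prop where
  contMDiff : ∀ d, ContMDiff 𝓘(ℝ, E) (𝓘(ℝ, E).prod 𝓘(ℝ, E →L[ℝ] E)) ∞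
    (fun p ↦ TotalSpace.mk' (E →L[ℝ] E)
      (E := fun p : M ↦ TangentSpace 𝓘(ℝ, E) p →L[ℝ] TangentSpace 𝓘(ℝ, E) p) p (J d p))
  inner_map : ∀ d p (u v : TangentSpace 𝓘(ℝ, E) p), ⟪J d p u, J d p v⟫_ℝ = ⟪u, v⟫_ℝ
  sq : ∀ d p (u : TangentSpace 𝓘(ℝ, E) p), J d p (J d p u) = -u
  mul : ∀ p (u : TangentSpace 𝓘(ℝ, E) p), J 0 p (J 1 p (J 2 p u)) = -u
  parallel : ∀ d p (u v : TangentSpace 𝓘(ℝ, E) p), covDerivEnd (J d) p u v = 0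

/-- The element `∑ c_d J_d` of the twistor family, for `c ∈ S² ⊆ ℝ³`. -/
def twistor (J : Fin 3 → ∀ p : M, TangentSpace 𝓘(ℝ, E) p →L[ℝ] TangentSpace 𝓘(ℝ, E) p)
    (c : EuclideanSpace ℝ (Fin 3)) (p : M) : TangentSpace 𝓘(ℝ, E) p →L[ℝ] TangentSpace 𝓘(ℝ, E) p :=
  ∑ d, c d • J d p

/-- The holomorphic symplectic form `Ω_J = ω_{JK} - √-1 ω_K` of `J = ∑ c_d J_d`, for
`K = ∑ k_d J_d` orthogonal to `J`, where `ω_A = ḡ(A ·, ·)`. -/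
def holSymplectic (J : Fin 3 → ∀ p : M, TangentSpace 𝓘(ℝ, E) p →L[ℝ] TangentSpace 𝓘(ℝ, E) p)
    (c k : EuclideanSpace ℝ (Fin 3)) (p : M) (u v : TangentSpace 𝓘(ℝ, E) p) : ℂ :=
  (⟪twistor J c p (twistor J k p u), v⟫_ℝ : ℂ) - Complex.I * (⟪twistor J k p u, v⟫_ℝ : ℂ)

variable {E₁ : Type*} [NormedAddCommGroup E₁] [NormedSpace ℝ E₁]
  {L : Type*} [TopologicalSpace L] [ChartedSpace E₁ L]

/-- `F : L → M` is hyper-Lagrangian with complex phase `Ψ : L → S²`: the map `Ψ` is smooth and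
`Ω_{Ψ(x)}` vanishes on `L` at every `x`.  The form `Ω_{Ψ(x)}` is determined by `Ψ(x)` up to a unit
complex factor, which depends on the choice of `K ∈ S²` orthogonal to `Ψ(x)`. -/
structure IsHyperLagrangian
    (J : Fin 3 → ∀ p : M, TangentSpace 𝓘(ℝ, E) p →L[ℝ] TangentSpace 𝓘(ℝ, E) p)
    (F : L → M) (Ψ : L → Metric.sphere (0 : EuclideanSpace ℝ (Fin 3)) 1) : Prop where
  contMDiff : ContMDiff 𝓘(ℝ, E₁) (𝓡 2) ∞ Ψ
  vanish : ∀ x, ∀ K ∈ Metric.sphere (0 : EuclideanSpace ℝ (Fin 3)) 1,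
    ⟪K, (Ψ x : EuclideanSpace ℝ (Fin 3))⟫_ℝ = 0 → ∀ u v : TangentSpace 𝓘(ℝ, E₁) x,
      holSymplectic J (Ψ x) K (F x)
        (mfderiv 𝓘(ℝ, E₁) 𝓘(ℝ, E) F x u) (mfderiv 𝓘(ℝ, E₁) 𝓘(ℝ, E) F x v) = 0

variable [FiniteDimensional ℝ E₁] [RiemannianBundle (fun x : L ↦ TangentSpace 𝓘(ℝ, E₁) x)]

/-- The energy density `|∇Ψ|² = ∑_d |∇a_d|² = ∑_{i,d} (da_d(eᵢ))²`, where `a : L → ℝ³` is `Ψ` seen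
as a map into `ℝ³` and `eᵢ` is an orthonormal basis of `T_x L`. -/
def energyDensity (Ψ : L → Metric.sphere (0 : EuclideanSpace ℝ (Fin 3)) 1) (x : L) : ℝ :=
  ∑ i, ∑ d : Fin 3,
    (show ℝ from mfderiv 𝓘(ℝ, E₁) 𝓘(ℝ, ℝ) (fun z : L ↦ (Ψ z : EuclideanSpace ℝ (Fin 3)) d) x
      (stdOrthonormalBasis ℝ (TangentSpace 𝓘(ℝ, E₁) x) i)) ^ 2

end Hyperkahler

/-- The twistor energy `T(L) = ∫_L |∇Ψ|² dμ`, possibly infinite. -/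
def twistorEnergy {m : ℕ} {L : Type*} [TopologicalSpace L]
    [ChartedSpace (EuclideanSpace ℝ (Fin m)) L]
    [RiemannianBundle (fun x : L ↦ TangentSpace (𝓡 m) x)] [MeasurableSpace L]
    (Ψ : L → Metric.sphere (0 : EuclideanSpace ℝ (Fin 3)) 1) : ℝ≥0∞ :=
  ∫⁻ x, ENNReal.ofReal (energyDensity (E₁ := EuclideanSpace ℝ (Fin m)) Ψ x) ∂riemannianVolume m L

end HyperLagrangian

end

/-! Fix `x`, let `a = Ψ(x)`, choose a unit vector `k ⟂ a` and put `k' = a × k`, so that the twistor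
elements `J = J_a`, `K = J_k` and `JK = J_{k'}` form a quaternionic triple. Vanishing of the form
says that `K` and `JK` carry the tangent plane into its orthogonal complement. By dimension `K`
carries it onto the complement, and therefore `J` preserves the tangent plane and induces an
isometry `T` of it.

The vanishing holds at all points near `x`, so for a fixed `c` in ℝ³ the form `ω_c = ḡ(J_c ·, ·)`
restricts to `⟨c, Ψ⟩ ω_Ψ` on `L`. Differentiate this at `x` for `c = k` and `c = k'`. As the `J_d`
are parallel, only the ambient derivative `B` of the tangent vectors and the derivative of the
coefficient survive (`inner_twistor_ambientDeriv`). Thus `h(w, v, u) = ⟨B(w, v), K u⟩`, the second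
fundamental form read through `K`, fails to be totally symmetric exactly by `κ = ⟨k, dΨ⟩` and `κ' =
⟨k', dΨ⟩`.

The rest is linear algebra (`norm_sq_trace_le`). The trace of `h` in its first two slots is
unchanged when `T` is inserted in both; moving the two copies of `T` into the third slot gives `T² =
-1`, so the trace equals its own negative plus corrections. Hence `⟨H, K u⟩ = κ(T u) - κ'(u)`. The
inequality `(s - t)² ≤ 2s² + 2t²` gives the constant 2, and Bessel's inequality for `k, k'` bounds
`κ² + κ'²` by the energy density. -/

noncomputable section

namespace HyperLagrangian

/-! ### Linear algebra of a tangent plane: the trace estimate -/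

section LinearAlgebra

variable {V : Type*} [NormedAddCommGroup V] [InnerProductSpace ℝ V] [FiniteDimensional ℝ V]
  {W : Type*} [NormedAddCommGroup W] [InnerProductSpace ℝ W]
  {ι : Type*} [Fintype ι]

/-- The trace of a bilinear form does not depend on the orthonormal basis. -/
theorem sum_bilin_orthonormalBasis (e f : OrthonormalBasis ι ℝ W) (b : W →ₗ[ℝ] W →ₗ[ℝ] ℝ) :
    ∑ i, b (f i) (f i) = ∑ i, b (e i) (e i) := by
  classical
  have h : ∀ i, b (f i) (f i)
      = ∑ j, ∑ k, (⟪e j, f i⟫_ℝ * ⟪f i, e k⟫_ℝ) * b (e j) (e k) := by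
    intro i
    conv_lhs => rw [← e.sum_repr' (f i)]
    simp only [map_sum, map_smul, LinearMap.sum_apply, LinearMap.smul_apply, smul_eq_mul,
      Finset.mul_sum]
    rw [Finset.sum_comm]
    refine Finset.sum_congr rfl fun j _ ↦ Finset.sum_congr rfl fun k _ ↦ ?_
    rw [real_inner_comm (e k) (f i)]
    ring
  simp only [h]
  rw [Finset.sum_comm]
  refine Finset.sum_congr rfl fun j _ ↦ ?_
  rw [Finset.sum_comm]
  simp only [← Finset.sum_mul, f.sum_inner_mul_inner]
  rw [Finset.sum_eq_single j]
  · simp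
  · intro k _ hk
    rw [e.inner_eq_zero hk.symm, zero_mul]
  · simp

/-- The trace of a bilinear form is invariant under a linear isometry. -/
theorem sum_bilin_isometry (e : OrthonormalBasis ι ℝ W) (T : W →ₗ[ℝ] W)
    (hT : ∀ u v, ⟪T u, T v⟫_ℝ = ⟪u, v⟫_ℝ) (b : W →ₗ[ℝ] W →ₗ[ℝ] ℝ) :
    ∑ i, b (T (e i)) (T (e i)) = ∑ i, b (e i) (e i) := by
  have : FiniteDimensional ℝ W := e.toBasis.finiteDimensional_of_finite
  let S : W ≃ₗᵢ[ℝ] W := (T.isometryOfInner hT).toLinearIsometryEquiv rfl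
  have := sum_bilin_orthonormalBasis e (e.map S) b
  simpa [S] using this

/-- If `K` maps a half-dimensional subspace to its orthogonal complement, then it maps it onto
the complement. -/
theorem orthogonal_range_eq (i : W →ₗᵢ[ℝ] V) [FiniteDimensional ℝ W]
    (hdim : Module.finrank ℝ V = 2 * Module.finrank ℝ W)
    (K : V →ₗ[ℝ] V) (hKi : ∀ u v, ⟪K u, K v⟫_ℝ = ⟪u, v⟫_ℝ)
    (hK : ∀ u v, ⟪K (i u), i v⟫_ℝ = 0) :
    (LinearMap.range i.toLinearMap)ᗮ = LinearMap.range (K ∘ₗ i.toLinearMap) := by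
  symm
  apply Submodule.eq_of_le_of_finrank_eq
  · rintro _ ⟨u, rfl⟩
    rw [Submodule.mem_orthogonal']
    rintro _ ⟨v, rfl⟩
    exact hK u v
  · have h1 := Submodule.finrank_add_finrank_orthogonal (LinearMap.range i.toLinearMap)
    have h2 : Module.finrank ℝ (LinearMap.range i.toLinearMap) = Module.finrank ℝ W :=
      LinearMap.finrank_range_of_inj i.injective
    have h3 : Module.finrank ℝ (LinearMap.range (K ∘ₗ i.toLinearMap)) = Module.finrank ℝ W := by
      refine LinearMap.finrank_range_of_inj ?_
      rw [LinearMap.coe_comp]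
      exact (K.isometryOfInner hKi).injective.comp i.injective
    omega

/-- The pointwise estimate: `B` is the ambient derivative of the tangent vectors, and `κ`, `κ'` are
the components of the derivative of the phase in the directions of `K` and `J K`. -/
theorem norm_sq_trace_le (i : W →ₗᵢ[ℝ] V) (e : OrthonormalBasis ι ℝ W)
    (hdim : Module.finrank ℝ V = 2 * Module.finrank ℝ W)
    (J K : V →ₗ[ℝ] V)
    (hJi : ∀ u v, ⟪J u, J v⟫_ℝ = ⟪u, v⟫_ℝ) (hKi : ∀ u v, ⟪K u, K v⟫_ℝ = ⟪u, v⟫_ℝ)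
    (hJJ : ∀ u, J (J u) = -u) (hKK : ∀ u, K (K u) = -u)
    (hKJ : ∀ u, K (J u) = -J (K u))
    (hK : ∀ u v, ⟪K (i u), i v⟫_ℝ = 0) (hJK : ∀ u v, ⟪J (K (i u)), i v⟫_ℝ = 0)
    (B : W →ₗ[ℝ] W →ₗ[ℝ] V) (hB : ∀ u v, B u v = B v u)
    (κ κ' : W →ₗ[ℝ] ℝ)
    (hκ : ∀ w u v, ⟪K (B w u), i v⟫_ℝ + ⟪K (i u), B w v⟫_ℝ = ⟪J (i u), i v⟫_ℝ * κ w)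
    (hκ' : ∀ w u v, ⟪J (K (B w u)), i v⟫_ℝ + ⟪J (K (i u)), B w v⟫_ℝ
      = ⟪J (i u), i v⟫_ℝ * κ' w) :
    ‖∑ j, (LinearMap.range i.toLinearMap)ᗮ.starProjection (B (e j) (e j))‖ ^ 2
      ≤ 2 * ∑ j, (κ (e j) ^ 2 + κ' (e j) ^ 2) := by
  classical
  have : FiniteDimensional ℝ W := e.toBasis.finiteDimensional_of_finite
  have hN := orthogonal_range_eq i hdim K hKi hK
  have hKskew : ∀ u v, ⟪K u, v⟫_ℝ = -⟪u, K v⟫_ℝ := by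
    intro u v
    rw [← hKi (K u) v, hKK, inner_neg_left]
  have hJskew : ∀ u v, ⟪J u, v⟫_ℝ = -⟪u, J v⟫_ℝ := by
    intro u v
    rw [← hJi (J u) v, hJJ, inner_neg_left]
  -- The plane is its own double complement and its complement is its image under `K`, so it
  -- suffices that `⟨J u, K v⟩ = 0`; this is `hJK` after anticommuting.
  have hmem : ∀ u, J (i u) ∈ LinearMap.range i.toLinearMap := by
    intro u
    rw [← Submodule.orthogonal_orthogonal (LinearMap.range i.toLinearMap), hN,
      Submodule.mem_orthogonal']
    rintro _ ⟨v, rfl⟩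
    have h1 := hJK u v
    simp only [LinearMap.coe_comp, Function.comp_apply, LinearIsometry.coe_toLinearMap]
    have h2 := hKskew (J (i u)) (i v)
    rw [hKJ, inner_neg_left, h1] at h2
    linarith
  choose T₀ hT₀ using hmem
  have hT₀' : ∀ u, i (T₀ u) = J (i u) := hT₀
  let T : W →ₗ[ℝ] W :=
    { toFun := T₀
      map_add' := fun u v ↦ i.injective (by simp [hT₀'])
      map_smul' := fun c u ↦ i.injective (by simp [hT₀']) }
  have hT : ∀ u, i (T u) = J (i u) := hT₀'
  have hTi : ∀ u v, ⟪T u, T v⟫_ℝ = ⟪u, v⟫_ℝ := fun u v ↦ by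
    rw [← i.inner_map_map, hT, hT, hJi, i.inner_map_map]
  have hTT : ∀ u, T (T u) = -u := fun u ↦ i.injective (by rw [hT, hT, hJJ, map_neg])
  have hTskew : ∀ u v, ⟪T u, v⟫_ℝ = -⟪u, T v⟫_ℝ := by
    intro u v
    rw [← hTi (T u) v, hTT, inner_neg_left]
  -- `K (i u)` is normal, so `h` depends only on the normal part of `B`.
  let h : W → W → W → ℝ := fun w v u ↦ ⟪B w v, K (i u)⟫_ℝ
  have hh : ∀ w v u, h w v u = ⟪B w v, K (i u)⟫_ℝ := fun _ _ _ ↦ rfl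
  have hrel : ∀ w u v, h w v u - h w u v = ⟪T u, v⟫_ℝ * κ w := by
    intro w u v
    have := hκ w u v
    rw [hKskew, real_inner_comm (B w v), ← hT, i.inner_map_map] at this
    simp only [hh]
    linarith
  have hrel' : ∀ w u v, - h w v (T u) + h w u (T v) = ⟪T u, v⟫_ℝ * κ' w := by
    intro w u v
    have := hκ' w u v
    rw [hJskew, hKskew, real_inner_comm (B w v), ← hT, ← hT, i.inner_map_map] at this
    have e1 : J (K (i u)) = - K (i (T u)) := by rw [hT, hKJ, neg_neg]
    rw [e1, inner_neg_right] at this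
    simp only [hh]
    linarith
  -- `T` passes from the second slot to the third: `h w u (T v)` cancels between the two relations.
  have hmove : ∀ w v u, h w (T v) u = h w v (T u) + κ w * ⟪u, v⟫_ℝ + κ' w * ⟪T u, v⟫_ℝ := by
    intro w v u
    have h1 := hrel w u (T v)
    have h2 := hrel' w u v
    rw [hTi] at h1
    linarith
  set H : V := ∑ j, (LinearMap.range i.toLinearMap)ᗮ.starProjection (B (e j) (e j)) with hH
  have hHmem : H ∈ (LinearMap.range i.toLinearMap)ᗮ :=
    Submodule.sum_mem _ fun j _ ↦ Submodule.starProjection_apply_mem _ _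
  have hKmem : ∀ u, K (i u) ∈ (LinearMap.range i.toLinearMap)ᗮ := fun u ↦ by
    rw [hN]
    exact ⟨u, rfl⟩
  have hHK : ∀ u, ⟪H, K (i u)⟫_ℝ = ∑ j, h (e j) (e j) u := by
    intro u
    rw [hH, sum_inner]
    refine Finset.sum_congr rfl fun j _ ↦ ?_
    rw [Submodule.inner_starProjection_left_eq_right,
      Submodule.starProjection_eq_self_iff.2 (hKmem u)]
  have hsumκ : ∀ (l : W →ₗ[ℝ] ℝ) u, ∑ j, l (e j) * ⟪u, e j⟫_ℝ = l u := by
    intro l u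
    conv_rhs => rw [← e.sum_repr' u]
    simp only [map_sum, map_smul, smul_eq_mul]
    refine Finset.sum_congr rfl fun j _ ↦ ?_
    rw [real_inner_comm, mul_comm]
  have hHu : ∀ u, ⟪H, K (i u)⟫_ℝ = κ (T u) - κ' u := by
    intro u
    have h1 : ∑ j, h (T (e j)) (T (e j)) u = ∑ j, h (e j) (e j) u := by
      simpa [hh, real_inner_comm] using
        sum_bilin_isometry e T hTi (B.compr₂ (innerₗ V (K (i u))))
    -- Move one `T` into the third slot, exchange the first two slots by symmetry of `B`, then move
    -- the other; the sign is `T² = -1`.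
    have h2 : ∀ j, h (T (e j)) (T (e j)) u = - h (e j) (e j) u
        + (κ (e j) * ⟪T u, e j⟫_ℝ + κ' (e j) * ⟪-u, e j⟫_ℝ)
        + ((κ ∘ₗ T) (e j) * ⟪u, e j⟫_ℝ + (κ' ∘ₗ T) (e j) * ⟪T u, e j⟫_ℝ) := by
      intro j
      have h3 : h (T (e j)) (e j) (T u) = h (e j) (T (e j)) (T u) := by
        simp only [hh, hB (T (e j))]
      have h4 : h (e j) (e j) (-u) = - h (e j) (e j) u := by simp [hh]
      rw [hmove, h3, hmove, hTT, h4]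
      simp only [LinearMap.comp_apply]
      ring
    simp only [h2, Finset.sum_add_distrib, Finset.sum_neg_distrib, hsumκ] at h1
    simp only [LinearMap.comp_apply, hTT, map_neg] at h1
    rw [hHK]
    linarith
  -- The norm of the normal vector `H` can be computed on the tangent plane, where Parseval applies,
  -- because `K` is an isometry onto the complement.
  obtain ⟨z, hz⟩ : ∃ z, K (i z) = H := by
    rw [hN] at hHmem
    exact hHmem
  have hnorm : ‖H‖ ^ 2 = ∑ j, (κ (T (e j)) - κ' (e j)) ^ 2 := by
    rw [← real_inner_self_eq_norm_sq]
    conv_lhs => rw [← hz]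
    rw [hKi, i.inner_map_map, ← e.sum_inner_mul_inner z z]
    refine Finset.sum_congr rfl fun j _ ↦ ?_
    rw [← hHu, ← hz, hKi, i.inner_map_map, real_inner_comm z (e j)]
    ring
  have hTκ : ∑ j, κ (T (e j)) ^ 2 = ∑ j, κ (e j) ^ 2 := by
    have := sum_bilin_isometry e T hTi ((LinearMap.mul ℝ ℝ).compl₁₂ κ κ)
    simpa [sq] using this
  calc ‖H‖ ^ 2 = ∑ j, (κ (T (e j)) - κ' (e j)) ^ 2 := hnorm
    _ ≤ ∑ j, (2 * κ (T (e j)) ^ 2 + 2 * κ' (e j) ^ 2) :=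
        Finset.sum_le_sum fun j _ ↦ by nlinarith [sq_nonneg (κ (T (e j)) + κ' (e j))]
    _ = 2 * ∑ j, (κ (e j) ^ 2 + κ' (e j) ^ 2) := by
        simp only [Finset.sum_add_distrib, ← Finset.mul_sum, hTκ]
        ring

end LinearAlgebra

/-! ### Metric and endomorphism fields in the preferred charts -/

section Charts

variable {E : Type*} [NormedAddCommGroup E] [NormedSpace ℝ E]
  {M : Type*} [TopologicalSpace M] [ChartedSpace E M] [IsManifold 𝓘(ℝ, E) ∞ M]

variable (E) in
/-- The components of a tangent vector at `p` in the preferred chart at `p`. -/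
def components (p : M) : TangentSpace 𝓘(ℝ, E) p →L[ℝ] E := ContinuousLinearMap.id ℝ E

theorem isManifold_one : IsManifold 𝓘(ℝ, E) 1 M := IsManifold.of_le (n := ∞) (by simp)

theorem coordFrame_coordCoframe (p : M) {y : E} (hy : y ∈ (extChartAt 𝓘(ℝ, E) p).target)
    (v : TangentSpace 𝓘(ℝ, E) ((extChartAt 𝓘(ℝ, E) p).symm y)) :
    coordFrame p y (coordCoframe p y v) = v := by
  have := isManifold_one (E := E) (M := M)
  have h := mfderivWithin_extChartAt_symm_comp_mfderiv_extChartAt (I := 𝓘(ℝ, E)) hy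
  simp only [ModelWithCorners.range_eq_univ, mfderivWithin_univ] at h
  exact congrArg (fun A ↦ A v) h

/-- The coordinate matrix represents `J` on the whole chart domain, not only at the centre, which is
what differentiation requires. -/
theorem coordEnd_extChartAt
    (J : ∀ p : M, TangentSpace 𝓘(ℝ, E) p →L[ℝ] TangentSpace 𝓘(ℝ, E) p) (p : M) {b : M}
    (hb : b ∈ (extChartAt 𝓘(ℝ, E) p).source) (u : TangentSpace 𝓘(ℝ, E) b) :
    coordEnd J p (extChartAt 𝓘(ℝ, E) p b)
        (mfderiv 𝓘(ℝ, E) 𝓘(ℝ, E) (extChartAt 𝓘(ℝ, E) p) b u : E)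
      = (mfderiv 𝓘(ℝ, E) 𝓘(ℝ, E) (extChartAt 𝓘(ℝ, E) p) b (J b u) : E) := by
  obtain ⟨y, hy, rfl⟩ : ∃ y ∈ (extChartAt 𝓘(ℝ, E) p).target, (extChartAt 𝓘(ℝ, E) p).symm y = b :=
    ⟨_, (extChartAt 𝓘(ℝ, E) p).map_source hb, (extChartAt 𝓘(ℝ, E) p).left_inv hb⟩
  -- The fibres depend on the base point, so the round trip through the chart cannot be rewritten
  -- directly; generalizing to `z = y` allows a substitution.
  have key : ∀ z, z = y → coordEnd J p z (coordCoframe p y u) = coordCoframe p y (J _ u) := by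
    rintro _ rfl
    simp only [coordEnd, ContinuousLinearMap.comp_apply]
    rw [coordFrame_coordCoframe p hy]
  exact key _ ((extChartAt 𝓘(ℝ, E) p).right_inv hy)

theorem coordEnd_self
    (J : ∀ p : M, TangentSpace 𝓘(ℝ, E) p →L[ℝ] TangentSpace 𝓘(ℝ, E) p) (p : M)
    (u : TangentSpace 𝓘(ℝ, E) p) :
    coordEnd J p (extChartAt 𝓘(ℝ, E) p p) (components E p u) = components E p (J p u) := by
  have h := coordEnd_extChartAt J p (mem_extChartAt_source (I := 𝓘(ℝ, E)) p) u
  have := isManifold_one (E := E) (M := M)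
  rw [mfderiv_extChartAt_self] at h
  exact h

/-- Identifies the bundle trivialization with the coordinate frame and coframe, so that smoothness
of a section becomes differentiability of its coordinate expression. -/
theorem eventually_coordFrame_eq (p : M) :
    ∀ᶠ y in nhds (extChartAt 𝓘(ℝ, E) p p), y ∈ (extChartAt 𝓘(ℝ, E) p).target ∧
      (extChartAt 𝓘(ℝ, E) p).symm y ∈ (chartAt E p).source ∧
      (trivializationAt E (TangentSpace 𝓘(ℝ, E)) p).symmL ℝ ((extChartAt 𝓘(ℝ, E) p).symm y)
        = coordFrame p y ∧
      (trivializationAt E (TangentSpace 𝓘(ℝ, E)) p).continuousLinearMapAt ℝ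
        ((extChartAt 𝓘(ℝ, E) p).symm y) = coordCoframe p y := by
  have := isManifold_one (E := E) (M := M)
  filter_upwards [(isOpen_extChartAt_target (I := 𝓘(ℝ, E)) p).mem_nhds (mem_extChartAt_target p)]
    with y hy
  have hs : (extChartAt 𝓘(ℝ, E) p).symm y ∈ (chartAt E p).source := by
    rw [← extChartAt_source 𝓘(ℝ, E)]
    exact (extChartAt 𝓘(ℝ, E) p).map_target hy
  refine ⟨hy, hs, ?_, ?_⟩
  · have h := TangentBundle.symmL_trivializationAt (I := 𝓘(ℝ, E)) (𝕜 := ℝ) hs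
    simp only [ModelWithCorners.range_eq_univ, mfderivWithin_univ] at h
    refine h.trans ?_
    have key : ∀ z, z = y → (mfderiv 𝓘(ℝ, E) 𝓘(ℝ, E) (extChartAt 𝓘(ℝ, E) p).symm z : E →L[ℝ] E)
      = mfderiv 𝓘(ℝ, E) 𝓘(ℝ, E) (extChartAt 𝓘(ℝ, E) p).symm y := by rintro _ rfl; rfl
    exact key _ ((extChartAt 𝓘(ℝ, E) p).right_inv hy)
  · exact TangentBundle.continuousLinearMapAt_trivializationAt (I := 𝓘(ℝ, E)) (𝕜 := ℝ) hs

theorem contMDiffAt_extChartAt_symm_self (p : M) :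
    ContMDiffAt 𝓘(ℝ, E) 𝓘(ℝ, E) ∞ (extChartAt 𝓘(ℝ, E) p).symm (extChartAt 𝓘(ℝ, E) p p) :=
  (contMDiffOn_extChartAt_symm (n := ∞) p).contMDiffAt (extChartAt_target_mem_nhds p)

theorem differentiableAt_comp_symm {G : Type*} [NormedAddCommGroup G] [NormedSpace ℝ G]
    {s : M → G} {p : M} (hs : ContMDiffAt 𝓘(ℝ, E) 𝓘(ℝ, G) ∞ s p) :
    DifferentiableAt ℝ (fun y ↦ s ((extChartAt 𝓘(ℝ, E) p).symm y)) (extChartAt 𝓘(ℝ, E) p p) := by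
  have h : ContMDiffAt 𝓘(ℝ, E) 𝓘(ℝ, G) ∞ s
      ((extChartAt 𝓘(ℝ, E) p).symm (extChartAt 𝓘(ℝ, E) p p)) := by
    rwa [extChartAt_to_inv]
  exact (h.comp _ (contMDiffAt_extChartAt_symm_self p)).contDiffAt.differentiableAt (by simp)

theorem differentiableAt_coordEnd
    (J : ∀ p : M, TangentSpace 𝓘(ℝ, E) p →L[ℝ] TangentSpace 𝓘(ℝ, E) p)
    (hJ : ContMDiff 𝓘(ℝ, E) (𝓘(ℝ, E).prod 𝓘(ℝ, E →L[ℝ] E)) ∞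
      (fun p ↦ TotalSpace.mk' (E →L[ℝ] E)
        (E := fun p : M ↦ TangentSpace 𝓘(ℝ, E) p →L[ℝ] TangentSpace 𝓘(ℝ, E) p) p (J p)))
    (p : M) : DifferentiableAt ℝ (coordEnd J p) (extChartAt 𝓘(ℝ, E) p p) := by
  have := isManifold_one (E := E) (M := M)
  have h := differentiableAt_comp_symm ((contMDiffAt_section p).1 (hJ p))
  refine h.congr_of_eventuallyEq ?_
  filter_upwards [eventually_coordFrame_eq p] with y ⟨_, hs, h1, h2⟩
  rw [hom_trivializationAt_apply]
  simp only [ContinuousLinearMap.inCoordinates]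
  rw [h1, h2]
  rfl

variable [RiemannianBundle (fun p : M ↦ TangentSpace 𝓘(ℝ, E) p)]

omit [IsManifold 𝓘(ℝ, E) ∞ M] in
theorem coordMetric_apply (p : M) (y u v : E) :
    coordMetric p y u v = ⟪coordFrame p y u, coordFrame p y v⟫_ℝ := rfl

theorem coordMetric_extChartAt (p : M) {b : M}
    (hb : b ∈ (extChartAt 𝓘(ℝ, E) p).source) (u v : TangentSpace 𝓘(ℝ, E) b) :
    coordMetric p (extChartAt 𝓘(ℝ, E) p b)
        (mfderiv 𝓘(ℝ, E) 𝓘(ℝ, E) (extChartAt 𝓘(ℝ, E) p) b u : E)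
        (mfderiv 𝓘(ℝ, E) 𝓘(ℝ, E) (extChartAt 𝓘(ℝ, E) p) b v : E)
      = ⟪u, v⟫_ℝ := by
  obtain ⟨y, hy, rfl⟩ : ∃ y ∈ (extChartAt 𝓘(ℝ, E) p).target, (extChartAt 𝓘(ℝ, E) p).symm y = b :=
    ⟨_, (extChartAt 𝓘(ℝ, E) p).map_source hb, (extChartAt 𝓘(ℝ, E) p).left_inv hb⟩
  have key : ∀ z, z = y → coordMetric p z (coordCoframe p y u) (coordCoframe p y v)
      = ⟪u, v⟫_ℝ := by
    rintro _ rfl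
    rw [coordMetric_apply, coordFrame_coordCoframe p hy, coordFrame_coordCoframe p hy]
  exact key _ ((extChartAt 𝓘(ℝ, E) p).right_inv hy)

theorem coordMetric_self (p : M) (u v : TangentSpace 𝓘(ℝ, E) p) :
    coordMetric p (extChartAt 𝓘(ℝ, E) p p) (components E p u) (components E p v) = ⟪u, v⟫_ℝ := by
  have h := coordMetric_extChartAt p (mem_extChartAt_source (I := 𝓘(ℝ, E)) p) u v
  have := isManifold_one (E := E) (M := M)
  rw [mfderiv_extChartAt_self] at h
  exact h

variable [IsContMDiffRiemannianBundle 𝓘(ℝ, E) ∞ E (fun p : M ↦ TangentSpace 𝓘(ℝ, E) p)]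

theorem differentiableAt_coordMetric (p : M) :
    DifferentiableAt ℝ (coordMetric p) (extChartAt 𝓘(ℝ, E) p p) := by
  have := isManifold_one (E := E) (M := M)
  obtain ⟨g, hg, hgi⟩ := IsContMDiffRiemannianBundle.exists_contMDiff (IB := 𝓘(ℝ, E)) (n := ∞)
    (F := E) (E := fun p : M ↦ TangentSpace 𝓘(ℝ, E) p)
  have h := differentiableAt_comp_symm ((contMDiffAt_section p).1 (hg p))
  refine h.congr_of_eventuallyEq ?_
  filter_upwards [eventually_coordFrame_eq p] with y ⟨_, hs, h1, h2⟩
  rw [hom_trivializationAt_apply]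
  ext u v
  have hb : (extChartAt 𝓘(ℝ, E) p).symm y
      ∈ (trivializationAt E (TangentSpace 𝓘(ℝ, E)) p).baseSet := by simpa using hs
  rw [inCoordinates_apply_eq₂ hb hb (by simp), coordMetric_apply, ← h1, hgi,
    Trivialization.symmL_apply _ hb, Trivialization.symmL_apply _ hb]
  simp

end Charts

/-! ### The Levi-Civita connection: torsion-free and metric -/

section LeviCivita

variable {E : Type*} [NormedAddCommGroup E] [NormedSpace ℝ E]
  {M : Type*} [TopologicalSpace M] [ChartedSpace E M] [IsManifold 𝓘(ℝ, E) ∞ M]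
  [RiemannianBundle (fun p : M ↦ TangentSpace 𝓘(ℝ, E) p)]
  [IsContMDiffRiemannianBundle 𝓘(ℝ, E) ∞ E (fun p : M ↦ TangentSpace 𝓘(ℝ, E) p)]

set_option synthInstance.maxHeartbeats 80000 in
theorem coordMetricDeriv_apply (p : M) (w u v : E) :
    coordMetricDeriv p w u v
      = fderiv ℝ (fun y ↦ coordMetric p y u v) (extChartAt 𝓘(ℝ, E) p p) w := by
  have h := (differentiableAt_coordMetric (E := E) p).hasFDerivAt
  have h2 := ((h.clm_apply (hasFDerivAt_const u _)).clm_apply (hasFDerivAt_const v _)).fderiv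
  rw [h2]
  simp [coordMetricDeriv]

theorem coordMetricDeriv_comm (p : M) (w u v : E) :
    coordMetricDeriv p w u v = coordMetricDeriv p w v u := by
  rw [coordMetricDeriv_apply, coordMetricDeriv_apply]
  congr 2
  ext y
  rw [coordMetric_apply, coordMetric_apply, real_inner_comm]

variable [FiniteDimensional ℝ E]

-- Koszul's formula for coordinate fields: identities for the connection reduce to symmetries of the
-- first derivatives of the metric.
omit [IsManifold 𝓘(ℝ, E) ∞ M]
  [IsContMDiffRiemannianBundle 𝓘(ℝ, E) ∞ E (fun p : M ↦ TangentSpace 𝓘(ℝ, E) p)] in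
theorem inner_christoffel (p : M) (u v w : TangentSpace 𝓘(ℝ, E) p) :
    ⟪christoffel p u v, w⟫_ℝ = 1 / 2 *
      (coordMetricDeriv p (components E p u) (components E p v) (components E p w)
      + coordMetricDeriv p (components E p v) (components E p u) (components E p w)
      - coordMetricDeriv p (components E p w) (components E p u) (components E p v)) := by
  have h : ⟪christoffel p u v, w⟫_ℝ
      = christoffelLower p (components E p u) (components E p v) (components E p w) :=
    InnerProductSpace.toDual_symm_apply
  rw [h]
  simp [christoffelLower]

theorem christoffel_comm (p : M) (u v : TangentSpace 𝓘(ℝ, E) p) :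
    christoffel p u v = christoffel p v u := by
  refine ext_inner_right ℝ fun w ↦ ?_
  rw [inner_christoffel, inner_christoffel, coordMetricDeriv_comm p (components E p w)]
  ring

/-- The Levi-Civita connection is metric. -/
theorem inner_christoffel_add_inner_christoffel (p : M) (w u v : TangentSpace 𝓘(ℝ, E) p) :
    ⟪christoffel p w u, v⟫_ℝ + ⟪u, christoffel p w v⟫_ℝ
      = coordMetricDeriv p (components E p w) (components E p u) (components E p v) := by
  rw [real_inner_comm _ u, inner_christoffel, inner_christoffel,
    coordMetricDeriv_comm p (components E p w) (components E p v),
    coordMetricDeriv_comm p (components E p v) (components E p w),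
    coordMetricDeriv_comm p (components E p u) (components E p w)]
  ring

set_option synthInstance.maxHeartbeats 80000 in
omit [IsManifold 𝓘(ℝ, E) ∞ M]
  [IsContMDiffRiemannianBundle 𝓘(ℝ, E) ∞ E (fun p : M ↦ TangentSpace 𝓘(ℝ, E) p)] in
theorem christoffel_add_left (p : M) (u u' v : TangentSpace 𝓘(ℝ, E) p) :
    christoffel p (u + u') v = christoffel p u v + christoffel p u' v := by
  refine ext_inner_right ℝ fun w ↦ ?_
  rw [inner_add_left]
  simp only [inner_christoffel, map_add, add_apply]
  ring

set_option synthInstance.maxHeartbeats 80000 in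
omit [IsManifold 𝓘(ℝ, E) ∞ M]
  [IsContMDiffRiemannianBundle 𝓘(ℝ, E) ∞ E (fun p : M ↦ TangentSpace 𝓘(ℝ, E) p)] in
theorem christoffel_smul_left (p : M) (c : ℝ) (u v : TangentSpace 𝓘(ℝ, E) p) :
    christoffel p (c • u) v = c • christoffel p u v := by
  refine ext_inner_right ℝ fun w ↦ ?_
  rw [real_inner_smul_left]
  simp only [inner_christoffel, map_smul, smul_apply, smul_eq_mul]
  ring

end LeviCivita

/-! ### A product rule -/

section Calculus

variable {E₁ : Type*} [NormedAddCommGroup E₁] [NormedSpace ℝ E₁]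
  {E₂ : Type*} [NormedAddCommGroup E₂] [NormedSpace ℝ E₂]

set_option synthInstance.maxHeartbeats 80000 in
/-- The product rule for the pullback of the bilinear form `g(j ·, ·)` under `f`. -/
theorem hasFDerivAt_bilinear_pullback {g : E₂ → E₂ →L[ℝ] E₂ →L[ℝ] ℝ} {j : E₂ → E₂ →L[ℝ] E₂}
    {f : E₁ → E₂} {y₀ : E₁} (hg : DifferentiableAt ℝ g (f y₀)) (hj : DifferentiableAt ℝ j (f y₀))
    (hf : ContDiffAt ℝ 2 f y₀) (u v : E₁) :
    ∃ A : E₁ →L[ℝ] ℝ,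
      HasFDerivAt (fun y ↦ g (f y) (j (f y) (fderiv ℝ f y u)) (fderiv ℝ f y v)) A y₀ ∧
      ∀ w, A w = fderiv ℝ g (f y₀) (fderiv ℝ f y₀ w) (j (f y₀) (fderiv ℝ f y₀ u)) (fderiv ℝ f y₀ v)
        + g (f y₀) (fderiv ℝ j (f y₀) (fderiv ℝ f y₀ w) (fderiv ℝ f y₀ u)) (fderiv ℝ f y₀ v)
        + g (f y₀) (j (f y₀) (fderiv ℝ (fderiv ℝ f) y₀ w u)) (fderiv ℝ f y₀ v)
        + g (f y₀) (j (f y₀) (fderiv ℝ f y₀ u)) (fderiv ℝ (fderiv ℝ f) y₀ w v) := by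
  have hf1 : HasFDerivAt f (fderiv ℝ f y₀) y₀ := (hf.differentiableAt (by simp)).hasFDerivAt
  have hf2 : HasFDerivAt (fderiv ℝ f) (fderiv ℝ (fderiv ℝ f) y₀) y₀ :=
    ((hf.fderiv_right (m := 1) (by norm_num)).differentiableAt (by simp)).hasFDerivAt
  have hu := hf2.clm_apply (hasFDerivAt_const u y₀)
  have hv := hf2.clm_apply (hasFDerivAt_const v y₀)
  refine ⟨_, ((hg.hasFDerivAt.comp y₀ hf1).clm_apply
    ((hj.hasFDerivAt.comp y₀ hf1).clm_apply hu)).clm_apply hv, fun w ↦ ?_⟩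
  simp
  ring

end Calculus

/-! ### Forms pulled back by the immersion, and their derivatives -/

section Immersion

variable {E₁ : Type*} [NormedAddCommGroup E₁] [NormedSpace ℝ E₁] [FiniteDimensional ℝ E₁]
  {E₂ : Type*} [NormedAddCommGroup E₂] [NormedSpace ℝ E₂] [FiniteDimensional ℝ E₂]
  {L : Type*} [TopologicalSpace L] [ChartedSpace E₁ L] [IsManifold 𝓘(ℝ, E₁) ∞ L]
  {M : Type*} [TopologicalSpace M] [ChartedSpace E₂ M] [IsManifold 𝓘(ℝ, E₂) ∞ M]

omit [FiniteDimensional ℝ E₁] [FiniteDimensional ℝ E₂] [IsManifold 𝓘(ℝ, E₁) ∞ L]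
  [IsManifold 𝓘(ℝ, E₂) ∞ M] in
theorem contDiffAt_writtenInExtChartAt {F : L → M} (hF : ContMDiff 𝓘(ℝ, E₁) 𝓘(ℝ, E₂) ∞ F) (x : L) :
    ContDiffAt ℝ ∞ (writtenInExtChartAt 𝓘(ℝ, E₁) 𝓘(ℝ, E₂) x F) (extChartAt 𝓘(ℝ, E₁) x x) := by
  have h := ((contMDiffAt_iff (n := ∞)).1 (hF x)).2
  rw [ModelWithCorners.range_eq_univ, contDiffWithinAt_univ] at h
  exact h

omit [FiniteDimensional ℝ E₁] [FiniteDimensional ℝ E₂] [IsManifold 𝓘(ℝ, E₁) ∞ L]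
  [IsManifold 𝓘(ℝ, E₂) ∞ M] in
theorem fderiv_writtenInExtChartAt {F : L → M} (hF : ContMDiff 𝓘(ℝ, E₁) 𝓘(ℝ, E₂) ∞ F) (x : L) :
    fderiv ℝ (writtenInExtChartAt 𝓘(ℝ, E₁) 𝓘(ℝ, E₂) x F) (extChartAt 𝓘(ℝ, E₁) x x)
      = (mfderiv 𝓘(ℝ, E₁) 𝓘(ℝ, E₂) F x : E₁ →L[ℝ] E₂) := by
  have h : MDifferentiableAt 𝓘(ℝ, E₁) 𝓘(ℝ, E₂) F x := (hF x).mdifferentiableAt (by simp)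
  simp [mfderiv, h]

omit [FiniteDimensional ℝ E₁] [FiniteDimensional ℝ E₂] in
/-- Near the centre of a chart, the coordinate expression of the differential of `F`. -/
theorem eventually_fderiv_writtenInExtChartAt {F : L → M}
    (hF : ContMDiff 𝓘(ℝ, E₁) 𝓘(ℝ, E₂) ∞ F) (x : L) :
    ∀ᶠ y in nhds (extChartAt 𝓘(ℝ, E₁) x x),
      F ((extChartAt 𝓘(ℝ, E₁) x).symm y) ∈ (extChartAt 𝓘(ℝ, E₂) (F x)).source ∧
      ∀ u : E₁, fderiv ℝ (writtenInExtChartAt 𝓘(ℝ, E₁) 𝓘(ℝ, E₂) x F) y u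
        = (mfderiv 𝓘(ℝ, E₂) 𝓘(ℝ, E₂) (extChartAt 𝓘(ℝ, E₂) (F x))
            (F ((extChartAt 𝓘(ℝ, E₁) x).symm y))
          (mfderiv 𝓘(ℝ, E₁) 𝓘(ℝ, E₂) F ((extChartAt 𝓘(ℝ, E₁) x).symm y) (coordFrame x y u)) : E₂) := by
  have hL := isManifold_one (E := E₁) (M := L)
  have hM := isManifold_one (E := E₂) (M := M)
  have hc : ContinuousAt (fun y ↦ F ((extChartAt 𝓘(ℝ, E₁) x).symm y))
      (extChartAt 𝓘(ℝ, E₁) x x) :=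
    hF.continuous.continuousAt.comp (continuousAt_extChartAt_symm x)
  have hmem : (extChartAt 𝓘(ℝ, E₂) (F x)).source
      ∈ nhds (F ((extChartAt 𝓘(ℝ, E₁) x).symm (extChartAt 𝓘(ℝ, E₁) x x))) := by
    rw [extChartAt_to_inv]
    exact extChartAt_source_mem_nhds _
  filter_upwards [hc hmem, extChartAt_target_mem_nhds (I := 𝓘(ℝ, E₁)) x] with y hy hyt
  have hy' : F ((extChartAt 𝓘(ℝ, E₁) x).symm y) ∈ (extChartAt 𝓘(ℝ, E₂) (F x)).source := hy
  refine ⟨hy', fun u ↦ ?_⟩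
  have h1 : MDifferentiableAt 𝓘(ℝ, E₁) 𝓘(ℝ, E₁) (extChartAt 𝓘(ℝ, E₁) x).symm y :=
    ((contMDiffOn_extChartAt_symm (n := 1) x).contMDiffAt
      ((isOpen_extChartAt_target x).mem_nhds hyt)).mdifferentiableAt (by simp)
  have h2 : MDifferentiableAt 𝓘(ℝ, E₁) 𝓘(ℝ, E₂) F ((extChartAt 𝓘(ℝ, E₁) x).symm y) :=
    (hF _).mdifferentiableAt (by simp)
  have h3 : MDifferentiableAt 𝓘(ℝ, E₂) 𝓘(ℝ, E₂) (extChartAt 𝓘(ℝ, E₂) (F x))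
      (F ((extChartAt 𝓘(ℝ, E₁) x).symm y)) :=
    mdifferentiableAt_extChartAt (by rwa [← extChartAt_source 𝓘(ℝ, E₂)])
  have h4 := mfderiv_comp y (h3.comp _ h2) h1
  rw [mfderiv_comp _ h3 h2] at h4
  have h5 : mfderiv 𝓘(ℝ, E₁) 𝓘(ℝ, E₂) (writtenInExtChartAt 𝓘(ℝ, E₁) 𝓘(ℝ, E₂) x F) y
    = fderiv ℝ (writtenInExtChartAt 𝓘(ℝ, E₁) 𝓘(ℝ, E₂) x F) y := mfderiv_eq_fderiv
  rw [← h5]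
  exact congrArg (fun A : E₁ →L[ℝ] E₂ ↦ A u) h4

variable [RiemannianBundle (fun p : M ↦ TangentSpace 𝓘(ℝ, E₂) p)]

/-- The form `ḡ(J dF u, dF v)` in the charts at `x` and `F x`. -/
def coordForm (J : ∀ p : M, TangentSpace 𝓘(ℝ, E₂) p →L[ℝ] TangentSpace 𝓘(ℝ, E₂) p) (F : L → M)
    (x : L) (u v : E₁) (y : E₁) : ℝ :=
  coordMetric (F x) (writtenInExtChartAt 𝓘(ℝ, E₁) 𝓘(ℝ, E₂) x F y)
    (coordEnd J (F x) (writtenInExtChartAt 𝓘(ℝ, E₁) 𝓘(ℝ, E₂) x F y)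
      (fderiv ℝ (writtenInExtChartAt 𝓘(ℝ, E₁) 𝓘(ℝ, E₂) x F) y u))
    (fderiv ℝ (writtenInExtChartAt 𝓘(ℝ, E₁) 𝓘(ℝ, E₂) x F) y v)

-- One neighbourhood serves all `J`, `u`, `v`, so a pointwise identity among several forms can be
-- differentiated at the centre.
omit [FiniteDimensional ℝ E₁] [FiniteDimensional ℝ E₂] in
theorem eventually_coordForm_eq {F : L → M}
    (hF : ContMDiff 𝓘(ℝ, E₁) 𝓘(ℝ, E₂) ∞ F) (x : L) :
    ∀ᶠ y in nhds (extChartAt 𝓘(ℝ, E₁) x x),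
      ∀ (J : ∀ p : M, TangentSpace 𝓘(ℝ, E₂) p →L[ℝ] TangentSpace 𝓘(ℝ, E₂) p) (u v : E₁),
      coordForm J F x u v y
        = ⟪J _ (mfderiv 𝓘(ℝ, E₁) 𝓘(ℝ, E₂) F ((extChartAt 𝓘(ℝ, E₁) x).symm y) (coordFrame x y u)),
          mfderiv 𝓘(ℝ, E₁) 𝓘(ℝ, E₂) F ((extChartAt 𝓘(ℝ, E₁) x).symm y) (coordFrame x y v)⟫_ℝ := by
  filter_upwards [eventually_fderiv_writtenInExtChartAt hF x] with y ⟨hs, hy⟩ J u v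
  rw [coordForm, hy, hy]
  exact (congrArg (fun z ↦ coordMetric (F x) _ z _) (coordEnd_extChartAt J (F x) hs _)).trans
    (coordMetric_extChartAt (F x) hs _ _)

omit [FiniteDimensional ℝ E₁] [FiniteDimensional ℝ E₂] [IsManifold 𝓘(ℝ, E₁) ∞ L] in
theorem coordForm_self {F : L → M} (hF : ContMDiff 𝓘(ℝ, E₁) 𝓘(ℝ, E₂) ∞ F) (x : L)
    (J : ∀ p : M, TangentSpace 𝓘(ℝ, E₂) p →L[ℝ] TangentSpace 𝓘(ℝ, E₂) p)
    (u v : TangentSpace 𝓘(ℝ, E₁) x) :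
    coordForm J F x (components E₁ x u) (components E₁ x v) (extChartAt 𝓘(ℝ, E₁) x x)
      = ⟪J _ (mfderiv 𝓘(ℝ, E₁) 𝓘(ℝ, E₂) F x u), mfderiv 𝓘(ℝ, E₁) 𝓘(ℝ, E₂) F x v⟫_ℝ := by
  have h0 : writtenInExtChartAt 𝓘(ℝ, E₁) 𝓘(ℝ, E₂) x F (extChartAt 𝓘(ℝ, E₁) x x)
      = extChartAt 𝓘(ℝ, E₂) (F x) (F x) := by simp [writtenInExtChartAt]
  rw [coordForm, h0, fderiv_writtenInExtChartAt hF]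
  exact (congrArg (fun z ↦ coordMetric (F x) _ z _) (coordEnd_self J (F x) _)).trans
    (coordMetric_self (F x) _ _)

variable [IsContMDiffRiemannianBundle 𝓘(ℝ, E₂) ∞ E₂ (fun p : M ↦ TangentSpace 𝓘(ℝ, E₂) p)]

omit [FiniteDimensional ℝ E₁] [IsManifold 𝓘(ℝ, E₁) ∞ L] in
set_option synthInstance.maxHeartbeats 80000 in
/-- If `J` is parallel, the form `ḡ(J dF u, dF v)` is differentiated by the Leibniz rule. -/
theorem hasFDerivAt_coordForm {F : L → M} (hF : ContMDiff 𝓘(ℝ, E₁) 𝓘(ℝ, E₂) ∞ F) (x : L)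
    (J : ∀ p : M, TangentSpace 𝓘(ℝ, E₂) p →L[ℝ] TangentSpace 𝓘(ℝ, E₂) p)
    (hJ : ContMDiff 𝓘(ℝ, E₂) (𝓘(ℝ, E₂).prod 𝓘(ℝ, E₂ →L[ℝ] E₂)) ∞
      (fun p ↦ TotalSpace.mk' (E₂ →L[ℝ] E₂)
        (E := fun p : M ↦ TangentSpace 𝓘(ℝ, E₂) p →L[ℝ] TangentSpace 𝓘(ℝ, E₂) p) p (J p)))
    (hpar : ∀ p u v, covDerivEnd J p u v = 0) (u v : TangentSpace 𝓘(ℝ, E₁) x) :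
    ∃ A : E₁ →L[ℝ] ℝ, HasFDerivAt (coordForm J F x (components E₁ x u) (components E₁ x v)) A
      (extChartAt 𝓘(ℝ, E₁) x x) ∧ ∀ w : TangentSpace 𝓘(ℝ, E₁) x, A (components E₁ x w)
        = ⟪J _ (ambientDeriv F x w u), mfderiv 𝓘(ℝ, E₁) 𝓘(ℝ, E₂) F x v⟫_ℝ
          + ⟪J _ (mfderiv 𝓘(ℝ, E₁) 𝓘(ℝ, E₂) F x u), ambientDeriv F x w v⟫_ℝ := by
  set f := writtenInExtChartAt 𝓘(ℝ, E₁) 𝓘(ℝ, E₂) x F with hf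
  set y₀ := extChartAt 𝓘(ℝ, E₁) x x with hy₀
  have h0 : f y₀ = extChartAt 𝓘(ℝ, E₂) (F x) (F x) := by simp [hf, hy₀, writtenInExtChartAt]
  have hfs : ContDiffAt ℝ ∞ f y₀ := contDiffAt_writtenInExtChartAt hF x
  obtain ⟨A, hA, hAw⟩ := hasFDerivAt_bilinear_pullback (g := coordMetric (F x))
    (j := coordEnd J (F x)) (f := f) (y₀ := y₀)
    (by rw [h0]; exact differentiableAt_coordMetric (F x))
    (by rw [h0]; exact differentiableAt_coordEnd J hJ (F x)) (hfs.of_le (by norm_cast))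
    (components E₁ x u) (components E₁ x v)
  refine ⟨A, hA, fun w ↦ (hAw _).trans ?_⟩
  have h1 : fderiv ℝ f y₀ = (mfderiv 𝓘(ℝ, E₁) 𝓘(ℝ, E₂) F x : E₁ →L[ℝ] E₂) :=
    fderiv_writtenInExtChartAt hF x
  have hU : ∀ z : TangentSpace 𝓘(ℝ, E₁) x, fderiv ℝ f y₀ (components E₁ x z)
      = components E₂ (F x) (mfderiv 𝓘(ℝ, E₁) 𝓘(ℝ, E₂) F x z) := fun z ↦
    congrArg (fun A : E₁ →L[ℝ] E₂ ↦ A z) h1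
  set p := F x with hp
  set U : TangentSpace 𝓘(ℝ, E₂) p := mfderiv 𝓘(ℝ, E₁) 𝓘(ℝ, E₂) F x u with hUdef
  set V : TangentSpace 𝓘(ℝ, E₂) p := mfderiv 𝓘(ℝ, E₁) 𝓘(ℝ, E₂) F x v with hVdef
  set Z : TangentSpace 𝓘(ℝ, E₂) p := mfderiv 𝓘(ℝ, E₁) 𝓘(ℝ, E₂) F x w with hZdef
  set a : TangentSpace 𝓘(ℝ, E₂) p :=
    (fderiv ℝ (fderiv ℝ f) y₀ (components E₁ x w) (components E₁ x u) : E₂) with ha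
  set b : TangentSpace 𝓘(ℝ, E₂) p :=
    (fderiv ℝ (fderiv ℝ f) y₀ (components E₁ x w) (components E₁ x v) : E₂) with hb
  set D : TangentSpace 𝓘(ℝ, E₂) p := (fderiv ℝ (coordEnd J p) (extChartAt 𝓘(ℝ, E₂) p p)
    (components E₂ p Z) (components E₂ p U) : E₂) with hD
  have hBu : ambientDeriv F x w u = a + christoffel p Z U := rfl
  have hBv : ambientDeriv F x w v = b + christoffel p Z V := rfl
  have hDp : D = J p (christoffel p Z U) - christoffel p Z (J p U) := by
    have h2 : D + christoffel p Z (J p U) - J p (christoffel p Z U) = 0 := hpar p Z U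
    rw [sub_eq_zero] at h2
    exact eq_sub_of_add_eq h2
  -- Metric compatibility splits the derivative of the metric into two Christoffel terms.
  -- Parallelism replaces `D` by a commutator, which cancels `Γ(Z, J U)` and leaves `J Γ(Z, U)`.
  have key : coordMetricDeriv p (components E₂ p Z) (components E₂ p (J p U)) (components E₂ p V)
      + coordMetric p (extChartAt 𝓘(ℝ, E₂) p p) (components E₂ p D) (components E₂ p V)
      + coordMetric p (extChartAt 𝓘(ℝ, E₂) p p) (components E₂ p (J p a)) (components E₂ p V)
      + coordMetric p (extChartAt 𝓘(ℝ, E₂) p p) (components E₂ p (J p U)) (components E₂ p b)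
      = ⟪J p (a + christoffel p Z U), V⟫_ℝ + ⟪J p U, b + christoffel p Z V⟫_ℝ := by
    rw [coordMetric_self, coordMetric_self, coordMetric_self,
      ← inner_christoffel_add_inner_christoffel, hDp]
    simp only [map_add, inner_add_left, inner_add_right, inner_sub_left]
    ring
  rw [hBu, hBv, ← key]
  have hJU : coordEnd J p (extChartAt 𝓘(ℝ, E₂) p p) (components E₂ p U) = (components E₂ p (J p U)) :=
    coordEnd_self J p U
  have hJa : coordEnd J p (extChartAt 𝓘(ℝ, E₂) p p) (components E₂ p a) = (components E₂ p (J p a)) :=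
    coordEnd_self J p a
  rw [← hJU, ← hJa]
  rw [hU, hU, hU, h0]
  rfl

end Immersion

/-! ### Euclidean three-space -/

section Space

/-- The cross product in oriented Euclidean three-space. -/
def cross (a k : EuclideanSpace ℝ (Fin 3)) : EuclideanSpace ℝ (Fin 3) :=
  !₂[a 1 * k 2 - a 2 * k 1, a 2 * k 0 - a 0 * k 2, a 0 * k 1 - a 1 * k 0]

theorem inner_eq_sum (a k : EuclideanSpace ℝ (Fin 3)) :
    ⟪a, k⟫_ℝ = a 0 * k 0 + a 1 * k 1 + a 2 * k 2 := by
  simp [PiLp.inner_apply, Fin.sum_univ_three]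
  ring

theorem inner_cross_left (a k : EuclideanSpace ℝ (Fin 3)) : ⟪cross a k, a⟫_ℝ = 0 := by
  rw [inner_eq_sum]
  simp [cross]
  ring

theorem inner_cross_right (a k : EuclideanSpace ℝ (Fin 3)) : ⟪cross a k, k⟫_ℝ = 0 := by
  rw [inner_eq_sum]
  simp [cross]
  ring

theorem inner_cross_self (a k : EuclideanSpace ℝ (Fin 3)) :
    ⟪cross a k, cross a k⟫_ℝ = ⟪a, a⟫_ℝ * ⟪k, k⟫_ℝ - ⟪a, k⟫_ℝ ^ 2 := by
  simp only [inner_eq_sum]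
  simp [cross]
  ring

theorem exists_unit_inner_eq_zero (a : EuclideanSpace ℝ (Fin 3)) :
    ∃ k : EuclideanSpace ℝ (Fin 3), ‖k‖ = 1 ∧ ⟪k, a⟫_ℝ = 0 := by
  by_cases h : a 0 = 0 ∧ a 1 = 0
  · refine ⟨EuclideanSpace.single 0 1, by simp, ?_⟩
    rw [inner_eq_sum]
    simp [h.1]
  · have hv : (!₂[-a 1, a 0, 0] : EuclideanSpace ℝ (Fin 3)) ≠ 0 := by
      intro h0
      apply h
      have h1 := congrArg (fun v : EuclideanSpace ℝ (Fin 3) ↦ v 0) h0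
      have h2 := congrArg (fun v : EuclideanSpace ℝ (Fin 3) ↦ v 1) h0
      simp at h1 h2
      exact ⟨h2, h1⟩
    refine ⟨(‖(!₂[-a 1, a 0, 0] : EuclideanSpace ℝ (Fin 3))‖)⁻¹ • !₂[-a 1, a 0, 0],
      norm_smul_inv_norm hv, ?_⟩
    rw [real_inner_smul_left, inner_eq_sum]
    simp
    right
    ring

/-- A vector that is orthogonal to every unit vector orthogonal to `a` is a multiple of `a`. -/
theorem inner_eq_of_forall_unit {a w : EuclideanSpace ℝ (Fin 3)} (ha : ‖a‖ = 1)
    (h : ∀ k, ‖k‖ = 1 → ⟪k, a⟫_ℝ = 0 → ⟪k, w⟫_ℝ = 0) (k : EuclideanSpace ℝ (Fin 3)) :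
    ⟪k, w⟫_ℝ = ⟪a, w⟫_ℝ * ⟪k, a⟫_ℝ := by
  set r := w - ⟪a, w⟫_ℝ • a with hr
  have hra : ⟪r, a⟫_ℝ = 0 := by
    rw [hr, inner_sub_left, real_inner_smul_left, real_inner_self_eq_norm_sq, ha,
      real_inner_comm w a]
    ring
  have hr0 : r = 0 := by
    by_contra hne
    have h1 := h (‖r‖⁻¹ • r) (norm_smul_inv_norm hne) (by rw [real_inner_smul_left, hra, mul_zero])
    rw [real_inner_smul_left, mul_eq_zero, inv_eq_zero, norm_eq_zero] at h1
    have h2 := h1.resolve_left hne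
    have h3 : ⟪r, r⟫_ℝ = 0 := by
      rw [show ⟪r, r⟫_ℝ = ⟪r, w - ⟪a, w⟫_ℝ • a⟫_ℝ from rfl, inner_sub_right, real_inner_smul_right,
        h2, hra]
      ring
    exact hne (inner_self_eq_zero.1 h3)
  rw [hr, sub_eq_zero] at hr0
  conv_lhs => rw [hr0]
  rw [real_inner_smul_right]

/-- Bessel's inequality. It is applied to a derivative of the phase, with `k, k'` spanning the plane
orthogonal to `Ψ(x)`. -/
theorem inner_sq_add_inner_sq_le {k k' : EuclideanSpace ℝ (Fin 3)} (hk : ‖k‖ = 1) (hk' : ‖k'‖ = 1)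
    (h : ⟪k, k'⟫_ℝ = 0) (w : EuclideanSpace ℝ (Fin 3)) :
    ⟪k, w⟫_ℝ ^ 2 + ⟪k', w⟫_ℝ ^ 2 ≤ ∑ d, w d ^ 2 := by
  have ho : Orthonormal ℝ ![k, k'] := by
    rw [orthonormal_iff_ite]
    intro i j
    fin_cases i <;> fin_cases j <;>
      simp [hk, hk', h, (real_inner_comm k k').trans h]
  have := ho.sum_inner_products_le (s := Finset.univ) (x := w)
  rw [EuclideanSpace.norm_sq_eq] at this
  simpa [Fin.sum_univ_two] using this

end Space

/-! ### Quaternionic algebra of the twistor family -/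

section Twistor

variable {E : Type*} [NormedAddCommGroup E] [NormedSpace ℝ E] [FiniteDimensional ℝ E]
  {M : Type*} [TopologicalSpace M] [ChartedSpace E M] [IsManifold 𝓘(ℝ, E) ∞ M]
  [RiemannianBundle (fun p : M ↦ TangentSpace 𝓘(ℝ, E) p)]
  {J : Fin 3 → ∀ p : M, TangentSpace 𝓘(ℝ, E) p →L[ℝ] TangentSpace 𝓘(ℝ, E) p}

omit [FiniteDimensional ℝ E] [IsManifold 𝓘(ℝ, E) ∞ M]
  [RiemannianBundle (fun p : M ↦ TangentSpace 𝓘(ℝ, E) p)] in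
theorem twistor_apply (c : EuclideanSpace ℝ (Fin 3)) (p : M) (u : TangentSpace 𝓘(ℝ, E) p) :
    twistor J c p u = c 0 • J 0 p u + c 1 • J 1 p u + c 2 • J 2 p u := by
  simp [twistor, Fin.sum_univ_three]

/-- The product rule of imaginary quaternions; the multiplication table follows from the squares and
`J₁J₂J₃ = -1`. -/
theorem twistor_twistor (hJ : IsHyperkahler J) (a k : EuclideanSpace ℝ (Fin 3)) (p : M)
    (u : TangentSpace 𝓘(ℝ, E) p) :
    twistor J a p (twistor J k p u) = -⟪a, k⟫_ℝ • u + twistor J (cross a k) p u := by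
  have h01 : ∀ u, J 0 p (J 1 p u) = J 2 p u := fun u ↦ by
    have := hJ.mul p (J 2 p u)
    rw [hJ.sq, map_neg, map_neg, neg_inj] at this
    exact this
  have h12 : ∀ u, J 1 p (J 2 p u) = J 0 p u := fun u ↦ by
    have := congrArg (J 0 p) (hJ.mul p u)
    rw [hJ.sq, map_neg, neg_inj] at this
    exact this
  have h02 : ∀ u, J 0 p (J 2 p u) = -J 1 p u := fun u ↦ by rw [← h01, hJ.sq]
  have h21 : ∀ u, J 2 p (J 1 p u) = -J 0 p u := fun u ↦ by rw [← h01, hJ.sq, map_neg]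
  have h10 : ∀ u, J 1 p (J 0 p u) = -J 2 p u := fun u ↦ by rw [← h12, hJ.sq]
  have h20 : ∀ u, J 2 p (J 0 p u) = J 1 p u := fun u ↦ by
    rw [← h01, h10, map_neg, h02, neg_neg]
  simp only [twistor_apply, map_add, map_smul, hJ.sq, h01, h12, h02, h21, h10, h20, inner_eq_sum]
  simp only [cross, PiLp.toLp_apply, Matrix.cons_val]
  module

/-- Each `J_d` is skew, being orthogonal with square `-1`, and skewness is linear in `c`. -/
theorem inner_twistor_left (hJ : IsHyperkahler J) (c : EuclideanSpace ℝ (Fin 3)) (p : M)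
    (u v : TangentSpace 𝓘(ℝ, E) p) :
    ⟪twistor J c p u, v⟫_ℝ = -⟪u, twistor J c p v⟫_ℝ := by
  have h : ∀ d, ⟪J d p u, v⟫_ℝ = -⟪u, J d p v⟫_ℝ := fun d ↦ by
    rw [← hJ.inner_map d p (J d p u), hJ.sq, inner_neg_left]
  simp only [twistor_apply, inner_add_left, inner_add_right, real_inner_smul_left,
    real_inner_smul_right, h]
  ring

theorem cross_self (a : EuclideanSpace ℝ (Fin 3)) : cross a a = 0 := by
  ext i
  fin_cases i <;> simp [cross, mul_comm]

theorem cross_comm (a k : EuclideanSpace ℝ (Fin 3)) : cross k a = -cross a k := by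
  ext i
  fin_cases i <;> simp [cross] <;> ring

theorem twistor_sq (hJ : IsHyperkahler J) {c : EuclideanSpace ℝ (Fin 3)} (hc : ‖c‖ = 1) (p : M)
    (u : TangentSpace 𝓘(ℝ, E) p) : twistor J c p (twistor J c p u) = -u := by
  rw [twistor_twistor hJ, real_inner_self_eq_norm_sq, hc, cross_self, twistor_apply]
  simp

theorem inner_twistor_twistor (hJ : IsHyperkahler J) {c : EuclideanSpace ℝ (Fin 3)} (hc : ‖c‖ = 1)
    (p : M) (u v : TangentSpace 𝓘(ℝ, E) p) :
    ⟪twistor J c p u, twistor J c p v⟫_ℝ = ⟪u, v⟫_ℝ := by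
  rw [inner_twistor_left hJ, twistor_sq hJ hc, inner_neg_right, neg_neg]

omit [FiniteDimensional ℝ E] [IsManifold 𝓘(ℝ, E) ∞ M] in
theorem inner_twistor (J : Fin 3 → ∀ p : M, TangentSpace 𝓘(ℝ, E) p →L[ℝ] TangentSpace 𝓘(ℝ, E) p)
    (c : EuclideanSpace ℝ (Fin 3)) (p : M) (u v : TangentSpace 𝓘(ℝ, E) p) :
    ⟪twistor J c p u, v⟫_ℝ = ∑ d, c d * ⟪J d p u, v⟫_ℝ := by
  simp only [twistor_apply, inner_add_left, real_inner_smul_left, Fin.sum_univ_three]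

end Twistor

/-! ### Differentiating the hyper-Lagrangian condition -/

section Immersion

variable {E₁ : Type*} [NormedAddCommGroup E₁] [NormedSpace ℝ E₁] [FiniteDimensional ℝ E₁]
  {E₂ : Type*} [NormedAddCommGroup E₂] [NormedSpace ℝ E₂] [FiniteDimensional ℝ E₂]
  {L : Type*} [TopologicalSpace L] [ChartedSpace E₁ L] [IsManifold 𝓘(ℝ, E₁) ∞ L]
  {M : Type*} [TopologicalSpace M] [ChartedSpace E₂ M] [IsManifold 𝓘(ℝ, E₂) ∞ M]
  [RiemannianBundle (fun p : M ↦ TangentSpace 𝓘(ℝ, E₂) p)]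
  [IsContMDiffRiemannianBundle 𝓘(ℝ, E₂) ∞ E₂ (fun p : M ↦ TangentSpace 𝓘(ℝ, E₂) p)]
  {F : L → M}

-- Second derivatives commute and the connection is torsion-free.
omit [FiniteDimensional ℝ E₁] [IsManifold 𝓘(ℝ, E₁) ∞ L] in
theorem ambientDeriv_comm (hF : ContMDiff 𝓘(ℝ, E₁) 𝓘(ℝ, E₂) ∞ F) (x : L)
    (u v : TangentSpace 𝓘(ℝ, E₁) x) : ambientDeriv (E₂ := E₂) F x u v = ambientDeriv (E₂ := E₂) F x v u := by
  have h := (contDiffAt_writtenInExtChartAt hF x).isSymmSndFDerivAt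
    (by simp only [minSmoothness_of_isRCLikeNormedField]; norm_cast)
  have h1 := h (components E₁ x u) (components E₁ x v)
  exact congrArg₂ (fun a b : TangentSpace 𝓘(ℝ, E₂) (F x) ↦ a + b) h1 (christoffel_comm _ _ _)

omit [FiniteDimensional ℝ E₁] [IsManifold 𝓘(ℝ, E₁) ∞ L] [IsManifold 𝓘(ℝ, E₂) ∞ M]
  [IsContMDiffRiemannianBundle 𝓘(ℝ, E₂) ∞ E₂ (fun p : M ↦ TangentSpace 𝓘(ℝ, E₂) p)] in
theorem ambientDeriv_add_left (x : L) (u u' v : TangentSpace 𝓘(ℝ, E₁) x) :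
    ambientDeriv (E₂ := E₂) F x (u + u') v = ambientDeriv (E₂ := E₂) F x u v + ambientDeriv (E₂ := E₂) F x u' v := by
  set f := writtenInExtChartAt 𝓘(ℝ, E₁) 𝓘(ℝ, E₂) x F with hf
  set D : E₁ →L[ℝ] E₁ →L[ℝ] E₂ := fderiv ℝ (fderiv ℝ f) (extChartAt 𝓘(ℝ, E₁) x x) with hD
  have h1 : D (components E₁ x (u + u')) (components E₁ x v)
      = D (components E₁ x u) (components E₁ x v) + D (components E₁ x u') (components E₁ x v) := by
    simp
  have h2 := christoffel_add_left (F x) (mfderiv 𝓘(ℝ, E₁) 𝓘(ℝ, E₂) F x u)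
    (mfderiv 𝓘(ℝ, E₁) 𝓘(ℝ, E₂) F x u') (mfderiv 𝓘(ℝ, E₁) 𝓘(ℝ, E₂) F x v)
  rw [← map_add] at h2
  refine (congrArg₂ (fun a b : TangentSpace 𝓘(ℝ, E₂) (F x) ↦ a + b) h1 h2).trans ?_
  exact add_add_add_comm (G := TangentSpace 𝓘(ℝ, E₂) (F x)) _ _ _ _

omit [FiniteDimensional ℝ E₁] [IsManifold 𝓘(ℝ, E₁) ∞ L] [IsManifold 𝓘(ℝ, E₂) ∞ M]
  [IsContMDiffRiemannianBundle 𝓘(ℝ, E₂) ∞ E₂ (fun p : M ↦ TangentSpace 𝓘(ℝ, E₂) p)] in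
theorem ambientDeriv_smul_left (x : L) (c : ℝ) (u v : TangentSpace 𝓘(ℝ, E₁) x) :
    ambientDeriv (E₂ := E₂) F x (c • u) v = c • ambientDeriv (E₂ := E₂) F x u v := by
  set f := writtenInExtChartAt 𝓘(ℝ, E₁) 𝓘(ℝ, E₂) x F with hf
  set D : E₁ →L[ℝ] E₁ →L[ℝ] E₂ := fderiv ℝ (fderiv ℝ f) (extChartAt 𝓘(ℝ, E₁) x x) with hD
  have h1 : D (components E₁ x (c • u)) (components E₁ x v)
      = c • D (components E₁ x u) (components E₁ x v) := by
    simp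
  have h2 := christoffel_smul_left (F x) c (mfderiv 𝓘(ℝ, E₁) 𝓘(ℝ, E₂) F x u)
    (mfderiv 𝓘(ℝ, E₁) 𝓘(ℝ, E₂) F x v)
  rw [← map_smul] at h2
  refine (congrArg₂ (fun a b : TangentSpace 𝓘(ℝ, E₂) (F x) ↦ a + b) h1 h2).trans ?_
  exact (smul_add (A := TangentSpace 𝓘(ℝ, E₂) (F x)) c _ _).symm

/-- `ambientDeriv` as a bilinear map. -/
def ambientBilin (hF : ContMDiff 𝓘(ℝ, E₁) 𝓘(ℝ, E₂) ∞ F) (x : L) :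
    TangentSpace 𝓘(ℝ, E₁) x →ₗ[ℝ] TangentSpace 𝓘(ℝ, E₁) x →ₗ[ℝ] TangentSpace 𝓘(ℝ, E₂) (F x) :=
  LinearMap.mk₂ ℝ (ambientDeriv (E₂ := E₂) F x) (ambientDeriv_add_left x) (ambientDeriv_smul_left x)
    (fun u v v' ↦ by
      rw [ambientDeriv_comm hF, ambientDeriv_add_left, ambientDeriv_comm hF x v,
        ambientDeriv_comm hF x v'])
    (fun c u v ↦ by rw [ambientDeriv_comm hF, ambientDeriv_smul_left, ambientDeriv_comm hF x v])

variable {J : Fin 3 → ∀ p : M, TangentSpace 𝓘(ℝ, E₂) p →L[ℝ] TangentSpace 𝓘(ℝ, E₂) p}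
  {Ψ : L → Metric.sphere (0 : EuclideanSpace ℝ (Fin 3)) 1}

/-- The differential of a coordinate of the phase, seen as a map into `ℝ³`. -/
def phaseCoordDeriv (Ψ : L → Metric.sphere (0 : EuclideanSpace ℝ (Fin 3)) 1) (x : L) (d : Fin 3) :
    TangentSpace 𝓘(ℝ, E₁) x →L[ℝ] ℝ :=
  mfderiv 𝓘(ℝ, E₁) 𝓘(ℝ, ℝ) (fun z : L ↦ (Ψ z : EuclideanSpace ℝ (Fin 3)) d) x

/-- The component of the differential of the phase in the direction of `k`. -/
def phaseDerivInner (Ψ : L → Metric.sphere (0 : EuclideanSpace ℝ (Fin 3)) 1) (x : L)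
    (k : EuclideanSpace ℝ (Fin 3)) : TangentSpace 𝓘(ℝ, E₁) x →ₗ[ℝ] ℝ :=
  ∑ d, k d • (phaseCoordDeriv Ψ x d).toLinearMap

omit [FiniteDimensional ℝ E₁] [IsManifold 𝓘(ℝ, E₁) ∞ L] in
theorem phaseDerivInner_apply (x : L) (k : EuclideanSpace ℝ (Fin 3))
    (w : TangentSpace 𝓘(ℝ, E₁) x) :
    phaseDerivInner Ψ x k w = ∑ d, k d * phaseCoordDeriv Ψ x d w := by
  simp [phaseDerivInner]

omit [FiniteDimensional ℝ E₁] in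
theorem hasFDerivAt_phase (hΨ : ContMDiff 𝓘(ℝ, E₁) (𝓡 2) ∞ Ψ) (x : L) (d : Fin 3) :
    HasFDerivAt (fun y ↦ (Ψ ((extChartAt 𝓘(ℝ, E₁) x).symm y) : EuclideanSpace ℝ (Fin 3)) d)
      (phaseCoordDeriv Ψ x d : E₁ →L[ℝ] ℝ)
      (extChartAt 𝓘(ℝ, E₁) x x) := by
  have hfact : Fact (Module.finrank ℝ (EuclideanSpace ℝ (Fin 3)) = 2 + 1) :=
    ⟨finrank_euclideanSpace_fin⟩
  have h0 : ContMDiff 𝓘(ℝ, E₁) 𝓘(ℝ, EuclideanSpace ℝ (Fin 3)) ∞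
      (fun z ↦ (Ψ z : EuclideanSpace ℝ (Fin 3))) := (contMDiff_coe_sphere (E := EuclideanSpace ℝ (Fin 3)) (n := 2)).comp hΨ
  have h1 : ContMDiff 𝓘(ℝ, E₁) 𝓘(ℝ, ℝ) ∞ (fun z ↦ (Ψ z : EuclideanSpace ℝ (Fin 3)) d) :=
    (EuclideanSpace.proj (𝕜 := ℝ) d).contDiff.contMDiff.comp h0
  have h2 : _ = (phaseCoordDeriv Ψ x d : E₁ →L[ℝ] ℝ) := fderiv_writtenInExtChartAt h1 x
  rw [← h2]
  exact (differentiableAt_comp_symm (h1 x)).hasFDerivAt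

omit [FiniteDimensional ℝ E₁] [FiniteDimensional ℝ E₂] [IsManifold 𝓘(ℝ, E₁) ∞ L]
  [IsManifold 𝓘(ℝ, E₂) ∞ M]
  [IsContMDiffRiemannianBundle 𝓘(ℝ, E₂) ∞ E₂ (fun p : M ↦ TangentSpace 𝓘(ℝ, E₂) p)] in
theorem inner_twistor_eq_zero (hΨ : IsHyperLagrangian (E₁ := E₁) J F Ψ) (z : L)
    (k : EuclideanSpace ℝ (Fin 3)) (hk : ‖k‖ = 1) (hkΨ : ⟪k, (Ψ z : EuclideanSpace ℝ (Fin 3))⟫_ℝ = 0)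
    (u v : TangentSpace 𝓘(ℝ, E₁) z) :
    ⟪twistor J (Ψ z) (F z) (twistor J k (F z) (mfderiv 𝓘(ℝ, E₁) 𝓘(ℝ, E₂) F z u)),
        mfderiv 𝓘(ℝ, E₁) 𝓘(ℝ, E₂) F z v⟫_ℝ = 0 ∧
      ⟪twistor J k (F z) (mfderiv 𝓘(ℝ, E₁) 𝓘(ℝ, E₂) F z u),
        mfderiv 𝓘(ℝ, E₁) 𝓘(ℝ, E₂) F z v⟫_ℝ = 0 := by
  have h := hΨ.vanish z k (by simpa using hk) hkΨ u v
  rw [holSymplectic, Complex.ext_iff] at h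
  simpa using h

omit [FiniteDimensional ℝ E₁] in
/-- The derivative of the condition that `L` is hyper-Lagrangian. -/
theorem inner_twistor_ambientDeriv (hJ : IsHyperkahler J)
    (hF : ContMDiff 𝓘(ℝ, E₁) 𝓘(ℝ, E₂) ∞ F) (hΨ : IsHyperLagrangian (E₁ := E₁) J F Ψ) (x : L)
    (k : EuclideanSpace ℝ (Fin 3)) (hk : ⟪k, (Ψ x : EuclideanSpace ℝ (Fin 3))⟫_ℝ = 0)
    (w u v : TangentSpace 𝓘(ℝ, E₁) x) :
    ⟪twistor J k (F x) (ambientDeriv (E₂ := E₂) F x w u), mfderiv 𝓘(ℝ, E₁) 𝓘(ℝ, E₂) F x v⟫_ℝ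
      + ⟪twistor J k (F x) (mfderiv 𝓘(ℝ, E₁) 𝓘(ℝ, E₂) F x u), ambientDeriv (E₂ := E₂) F x w v⟫_ℝ
      = ⟪twistor J (Ψ x) (F x) (mfderiv 𝓘(ℝ, E₁) 𝓘(ℝ, E₂) F x u),
          mfderiv 𝓘(ℝ, E₁) 𝓘(ℝ, E₂) F x v⟫_ℝ * phaseDerivInner Ψ x k w := by
  choose A hA hAw using fun d ↦
    hasFDerivAt_coordForm hF x (J d) (hJ.contMDiff d) (hJ.parallel d) u v
  set y₀ := extChartAt 𝓘(ℝ, E₁) x x with hy₀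
  let a : Fin 3 → E₁ → ℝ :=
    fun d y ↦ (Ψ ((extChartAt 𝓘(ℝ, E₁) x).symm y) : EuclideanSpace ℝ (Fin 3)) d
  have ha := hasFDerivAt_phase hΨ.contMDiff x
  have haΨ : ∀ d, a d y₀ = (Ψ x : EuclideanSpace ℝ (Fin 3)) d := fun d ↦ by
    simp only [a, hy₀, extChartAt_to_inv]
  have hleft := HasFDerivAt.fun_sum (u := Finset.univ) fun d _ ↦ (hA d).const_mul (k d)
  have hr1 := HasFDerivAt.fun_sum (u := Finset.univ) fun d _ ↦ (ha d).mul (hA d)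
  have hr2 := HasFDerivAt.fun_sum (u := Finset.univ) fun d _ ↦ (ha d).const_mul (k d)
  have hright := hr1.mul hr2
  -- At each nearby point the vector `(ω_d(u, v))_d` in ℝ³ is orthogonal to every unit vector
  -- orthogonal to the phase, hence a multiple of the phase: `ω_k = ω_Ψ ⟨k, Ψ⟩` with `k` fixed.
  have heq : (fun y ↦ ∑ d, k d * coordForm (J d) F x (components E₁ x u) (components E₁ x v) y)
      =ᶠ[nhds y₀] fun y ↦
        (∑ d, a d y * coordForm (J d) F x (components E₁ x u) (components E₁ x v) y)
          * ∑ d, k d * a d y := by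
    filter_upwards [eventually_coordForm_eq hF x] with y hy
    simp only [hy]
    have h1 := inner_eq_of_forall_unit (a := Ψ ((extChartAt 𝓘(ℝ, E₁) x).symm y))
      (w := WithLp.toLp 2 fun d ↦ coordForm (J d) F x (components E₁ x u) (components E₁ x v) y)
      (by simp) (fun k' hk' hk'a ↦ by
        have h2 := (inner_twistor_eq_zero hΨ _ k' hk' hk'a
          (coordFrame x y (components E₁ x u)) (coordFrame x y (components E₁ x v))).2
        rw [inner_twistor] at h2
        rw [inner_eq_sum]
        simp only [hy]
        rw [← h2, Fin.sum_univ_three]) k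
    simpa only [inner_eq_sum, hy, Fin.sum_univ_three] using h1
  have hfd := hleft.unique (hright.congr_of_eventuallyEq heq)
  have hfdw := congrArg (fun B : E₁ →L[ℝ] ℝ ↦ B (components E₁ x w)) hfd
  -- This removes the term containing the derivative of `ω_Ψ`.
  have hk0 : ∑ d, k d * a d y₀ = 0 := by
    simp only [haΨ]
    rw [← hk, inner_eq_sum, Fin.sum_univ_three]
  have hJa : ⟪twistor J (Ψ x) (F x) (mfderiv 𝓘(ℝ, E₁) 𝓘(ℝ, E₂) F x u),
      mfderiv 𝓘(ℝ, E₁) 𝓘(ℝ, E₂) F x v⟫_ℝ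
      = ∑ d, a d y₀ * coordForm (J d) F x (components E₁ x u) (components E₁ x v) y₀ := by
    rw [inner_twistor]
    refine Finset.sum_congr rfl fun d _ ↦ ?_
    rw [haΨ, hy₀, coordForm_self hF]
  have hkda : phaseDerivInner Ψ x k w
      = ∑ d, k d * (phaseCoordDeriv Ψ x d : E₁ →L[ℝ] ℝ) (components E₁ x w) :=
    phaseDerivInner_apply x k w
  rw [hJa, hkda, inner_twistor, inner_twistor, ← Finset.sum_add_distrib]
  simp only [← mul_add, ← hAw]
  simp only [add_apply, smul_apply, FunLike.coe_sum, Finset.sum_apply, smul_eq_mul] at hfdw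
  exact (hfdw.trans (congrArg₂ (· + ·) rfl (mul_eq_zero_of_left hk0 _))).trans (add_zero _)

end Immersion

/-! ### The pointwise estimate -/

section Estimate

variable {E₁ : Type*} [NormedAddCommGroup E₁] [NormedSpace ℝ E₁] [FiniteDimensional ℝ E₁]
  {E₂ : Type*} [NormedAddCommGroup E₂] [NormedSpace ℝ E₂] [FiniteDimensional ℝ E₂]
  {L : Type*} [TopologicalSpace L] [ChartedSpace E₁ L] [IsManifold 𝓘(ℝ, E₁) ∞ L]
  [RiemannianBundle (fun x : L ↦ TangentSpace 𝓘(ℝ, E₁) x)]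
  {M : Type*} [TopologicalSpace M] [ChartedSpace E₂ M] [IsManifold 𝓘(ℝ, E₂) ∞ M]
  [RiemannianBundle (fun p : M ↦ TangentSpace 𝓘(ℝ, E₂) p)]
  [IsContMDiffRiemannianBundle 𝓘(ℝ, E₂) ∞ E₂ (fun p : M ↦ TangentSpace 𝓘(ℝ, E₂) p)]
  {F : L → M}
  {J : Fin 3 → ∀ p : M, TangentSpace 𝓘(ℝ, E₂) p →L[ℝ] TangentSpace 𝓘(ℝ, E₂) p}
  {Ψ : L → Metric.sphere (0 : EuclideanSpace ℝ (Fin 3)) 1}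

/-- The squared norm of the mean curvature of a hyper-Lagrangian submanifold is at most twice the
energy density of its complex phase. -/
theorem norm_meanCurvature_sq_le (hdim : Module.finrank ℝ E₂ = 2 * Module.finrank ℝ E₁)
    (hJ : IsHyperkahler J) (hF : IsIsometricImmersion (E₁ := E₁) (E₂ := E₂) F)
    (hΨ : IsHyperLagrangian (E₁ := E₁) J F Ψ) (x : L) :
    ‖meanCurvature (E₁ := E₁) (E₂ := E₂) F x‖ ^ 2 ≤ 2 * energyDensity (E₁ := E₁) Ψ x := by
  set a : EuclideanSpace ℝ (Fin 3) := (Ψ x).1 with ha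
  have hanorm : ‖a‖ = 1 := by simp [ha]
  obtain ⟨k, hk, hka⟩ := exists_unit_inner_eq_zero a
  -- With this choice `J_{k'} = J_a J_k`, so the real and imaginary parts of the form belong to `k'`
  -- and `k`.
  set k' := cross a k with hk'def
  have hak : ⟪a, k⟫_ℝ = 0 := by rw [real_inner_comm, hka]
  have hk' : ‖k'‖ = 1 := by
    have h := inner_cross_self a k
    rw [hak, real_inner_self_eq_norm_sq, real_inner_self_eq_norm_sq, real_inner_self_eq_norm_sq,
      hanorm, hk] at h
    exact (pow_eq_one_iff_of_nonneg (norm_nonneg _) two_ne_zero).1 (by rw [h]; norm_num)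
  have hk'a : ⟪k', a⟫_ℝ = 0 := inner_cross_left a k
  have hkk' : ⟪k, k'⟫_ℝ = 0 := by rw [real_inner_comm, hk'def, inner_cross_right]
  have hJK : ∀ u, twistor J a (F x) (twistor J k (F x) u) = twistor J k' (F x) u := fun u ↦ by
    rw [twistor_twistor hJ, hak]
    simp [hk'def]
  have hKJ : ∀ u, twistor J k (F x) (twistor J a (F x) u)
      = -twistor J a (F x) (twistor J k (F x) u) := fun u ↦ by
    rw [hJK, twistor_twistor hJ, hka, cross_comm a k, ← hk'def]
    simp only [twistor_apply, PiLp.neg_apply]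
    module
  let i : TangentSpace 𝓘(ℝ, E₁) x →ₗᵢ[ℝ] TangentSpace 𝓘(ℝ, E₂) (F x) :=
    (mfderiv 𝓘(ℝ, E₁) 𝓘(ℝ, E₂) F x).toLinearMap.isometryOfInner (hF.inner_mfderiv x)
  have hrel := fun c hc w u v ↦ inner_twistor_ambientDeriv (k := c) hJ hF.contMDiff hΨ x hc w u v
  have key := norm_sq_trace_le i (stdOrthonormalBasis ℝ (TangentSpace 𝓘(ℝ, E₁) x)) hdim
    (twistor J a (F x)).toLinearMap (twistor J k (F x)).toLinearMap
    (inner_twistor_twistor hJ hanorm _) (inner_twistor_twistor hJ hk _)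
    (twistor_sq hJ hanorm _) (twistor_sq hJ hk _) hKJ
    (fun u v ↦ (inner_twistor_eq_zero hΨ x k hk hka u v).2)
    (fun u v ↦ (inner_twistor_eq_zero hΨ x k hk hka u v).1)
    (ambientBilin hF.contMDiff x) (ambientDeriv_comm hF.contMDiff x)
    (phaseDerivInner Ψ x k) (phaseDerivInner Ψ x k')
    (hrel k hka)
    (fun w u v ↦ by
      have h := hrel k' hk'a w u v
      rw [← hJK, ← hJK] at h
      exact h)
  refine key.trans (mul_le_mul_of_nonneg_left (Finset.sum_le_sum fun j _ ↦ ?_) zero_le_two)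
  have h := inner_sq_add_inner_sq_le hk hk' hkk' (WithLp.toLp 2 fun d ↦
    phaseCoordDeriv Ψ x d (stdOrthonormalBasis ℝ (TangentSpace 𝓘(ℝ, E₁) x) j))
  rw [phaseDerivInner_apply, phaseDerivInner_apply, Fin.sum_univ_three, Fin.sum_univ_three]
  rw [inner_eq_sum, inner_eq_sum] at h
  exact h

end Estimate

end HyperLagrangian

end

/-! ### The pointwise and integrated inequalities -/

theorem proposition2p3 (n : ℕ)
    {M : Type*} [TopologicalSpace M] [T2Space M] [SecondCountableTopology M]
    [ChartedSpace (EuclideanSpace ℝ (Fin (4 * n))) M] [IsManifold (𝓡 (4 * n)) ∞ M]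
    [RiemannianBundle (fun p : M ↦ TangentSpace (𝓡 (4 * n)) p)]
    [IsContMDiffRiemannianBundle (𝓡 (4 * n)) ∞ (EuclideanSpace ℝ (Fin (4 * n)))
      (fun p : M ↦ TangentSpace (𝓡 (4 * n)) p)]
    (J : Fin 3 → ∀ p : M, TangentSpace (𝓡 (4 * n)) p →L[ℝ] TangentSpace (𝓡 (4 * n)) p)
    (hJ : HyperLagrangian.IsHyperkahler J)
    {L : Type*} [TopologicalSpace L] [T2Space L] [SecondCountableTopology L]
    [MeasurableSpace L] [BorelSpace L]
    [ChartedSpace (EuclideanSpace ℝ (Fin (2 * n))) L] [IsManifold (𝓡 (2 * n)) ∞ L]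
    [RiemannianBundle (fun x : L ↦ TangentSpace (𝓡 (2 * n)) x)]
    (F : L → M)
    (hF : HyperLagrangian.IsIsometricImmersion (E₁ := EuclideanSpace ℝ (Fin (2 * n)))
      (E₂ := EuclideanSpace ℝ (Fin (4 * n))) F)
    (Ψ : L → Metric.sphere (0 : EuclideanSpace ℝ (Fin 3)) 1)
    (hΨ : HyperLagrangian.IsHyperLagrangian (E₁ := EuclideanSpace ℝ (Fin (2 * n))) J F Ψ) :
    (∀ x : L,
      ‖HyperLagrangian.meanCurvature (E₁ := EuclideanSpace ℝ (Fin (2 * n)))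
          (E₂ := EuclideanSpace ℝ (Fin (4 * n))) F x‖ ^ 2
        ≤ 2 * HyperLagrangian.energyDensity (E₁ := EuclideanSpace ℝ (Fin (2 * n))) Ψ x) ∧
    ∫⁻ x, ENNReal.ofReal
        (‖HyperLagrangian.meanCurvature (E₁ := EuclideanSpace ℝ (Fin (2 * n)))
          (E₂ := EuclideanSpace ℝ (Fin (4 * n))) F x‖ ^ 2)
        ∂HyperLagrangian.riemannianVolume (2 * n) L
      ≤ 2 * HyperLagrangian.twistorEnergy (m := 2 * n) Ψ := by
  have hpt := HyperLagrangian.norm_meanCurvature_sq_le (by simp; ring) hJ hF hΨ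
  refine ⟨hpt, ?_⟩
  -- The factor 2 is finite, so it passes through the integral with no measurability of the energy
  -- density.
  rw [HyperLagrangian.twistorEnergy, ← lintegral_const_mul' _ _ (by simp)]
  refine lintegral_mono fun x ↦ ?_
  refine (ENNReal.ofReal_le_ofReal (hpt x)).trans_eq ?_
  rw [ENNReal.ofReal_mul zero_le_two, ENNReal.ofReal_ofNat]
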